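/- **Calculus.** Labels are $k ::= 1\mid 0\mid u$ (strict, vacuous, undetermined). Types are $A::=a\mid A_1\to^k A_2$ and terms are $M::=c\mid x\mid\lambda x^k{:}A.\,M\mid M_1\,M_2^k$. Terms are taken up to renaming of bound variables, and contexts up to order. Over a signature $\Sigma$ with finitely many constants, the judgment $\Gamma;\Omega;\Delta\vdash M:A$ (unrestricted; irrelevant; strict variables) is given by the following rules. - $\Gamma;\Omega;\cdot\vdash c:A$ if $c{:}A\in\Sigma$; $(\Gamma,x{:}A);\Omega;\cdot\vdash x:A$; $\Gamma;\Omega;x{:}A\vdash x:A$. - $\Gamma;\Omega;\Delta\vdash\lambda x^k{:}A.M:A\to^kB$ if $M:B$ after adding $x{:}A$ to $\Gamma$, $\Omega$, $\Delta$ for $k=u,0,1$ respectively. - $\Gamma;\Omega;\Delta\vdash M\,N^u:B$ if $\Gamma;\Omega;\Delta\vdash M:A\to^uB$ and $(\Gamma,\Delta);\Omega;\cdot\vdash N:A$. - $\Gamma;\Omega;\Delta\vdash M\,N^0:B$ if $\Gamma;\Omega;\Delta\vdash M:A\to^0B$ and $(\Gamma,\Omega,\Delta);\cdot;\cdot\vdash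 N:A$. - $\Gamma;\Omega;(\Delta_M,\Delta_N)\vdash M\,N^1:B$ if $(\Gamma,\Delta_N);\Omega;\Delta_M\vdash M:A\to^1B$ and $(\Gamma,\Delta_M);\Omega;\Delta_N\vdash N:A$. Write $\Gamma;\Omega;\Delta\vdash M\Uparrow A$ if moreover $M$ is canonical, i.e. derivable in the $\beta$-normal, $\eta$-long version of these rules. Write $\Psi\vdash\ldots$ for $\Psi;\cdot;\cdot\vdash\ldots$. Simple types (built with $\to$) are embedded by $a^{\pm}=a$, $(A\to B)^+=A^-\to^1B^+$, $(A\to B)^-=A^+\to^uB^-$. Below, $\Sigma$ and $\Psi$ declare types of the form $B^+$, and $A$ has the form $B^-$. **Patterns.** Simple patterns are $N::=\lambda x^u{:}A.N\mid h\,N_1^1\ldots N_m^1\mid E\,\Phi$, where $h$ is a constant or a variable. The existential variable $E$ is applied to all variables in scope, in a standard order, with labels given by $\Phi$, and $E\,\Phi$ has base type. Patterns are linear (each existential variable occurs once) and are taken up to renaming of their existential variables. $\Psi\vdash N\Uparrow A$ means that $N$ is well typed with $E\,\Phi\Uparrow a$ allowed at any base type $a$. Ground instances are canonical terms $M$ without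 existential variables, as follows. $M\in\|E\,\Phi\|:a$ iff $\Gamma;\Omega;\Delta\vdash M:a$, where $\Gamma,\Omega,\Delta$ contain the variables with $\Phi$-label $u,0,1$. $\lambda x^u{:}A.M\in\|\lambda x^u{:}A.N\|$ iff $M\in\|N\|$ in $\Psi,x{:}A$. $h\,M_1^1\ldots M_m^1\in\|h\,N_1^1\ldots N_m^1\|$ iff $M_i\in\|N_i\|$ for all $i$. For a set $\mathcal N$ of patterns, $\|\mathcal N\|=\bigcup_{N\in\mathcal N}\|N\|$. Let $\mathrm{Pat}_A(\Psi)$ be the collection of finite sets of simple linear patterns $N$ with $\Psi\vdash N\Uparrow A$, and let $\mathcal M\simeq\mathcal N$ iff $\|\mathcal M\|=\|\mathcal N\|$. For a negative type $A=A_1\to^u\cdots A_n\to^ua$, let $\langle\Phi\rangle_A=\lambda y_1^u{:}A_1\ldots\lambda y_n^u{:}A_n.\,E\,\Phi\,y_1^u\ldots y_n^u$ with $E$ fresh, and let $\top_A=\langle\Psi^u\rangle_A$, where $\Psi^u$ labels every variable in scope with $u$. **Complement.** $\mathrm{Not}(M)$ is the set of all $N$ with $\Psi\vdash\mathrm{Not}(M)\Rightarrow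 N:A$, defined by: - $\mathrm{Not}(E\,\Phi)\Rightarrow Z\,\Phi'$ for each $x$ with $\Phi(x)\ne u$, where $\Phi'(x)$ is the other element of $\{0,1\}$ and $\Phi'$ is $u$ elsewhere; - $\mathrm{Not}(\lambda x^u{:}A.M)\Rightarrow\lambda x^u{:}A.N$ if $\mathrm{Not}(M)\Rightarrow N$ in $\Psi,x{:}A$; - at base type $a$: $\mathrm{Not}(h\,M_1^1\ldots M_n^1)\Rightarrow g\,\top_{A_1}^1\ldots\top_{A_m}^1$ for every $g\neq h$ in $\Sigma,\Psi$ with $g:A_1\to^1\cdots A_m\to^1a$; - for $h:A_1\to^1\cdots A_n\to^1a$: $\mathrm{Not}(h\,M_1^1\ldots M_n^1)\Rightarrow h\,\top_{A_1}^1\ldots N^1\ldots\top_{A_n}^1$ with $N$ in position $i$, if $\mathrm{Not}(M_i)\Rightarrow N$. **Intersection.** $M\cap N$ is the set of all $Q$ with $\Psi\vdash M\cap N\Rightarrow Q:A$, defined by the following rules and the mirror image of the second one. On labels, $u\cap k=k\cap u=k$, $k\cap k=k$, and $0\cap1$, $1\cap 0$ are undefined. - $E_1\Phi_1\cap E_2\Phi_2\Rightarrow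 H\,(\Phi_1\cap\Phi_2)$ if $\Phi_1\cap\Phi_2$ (taken pointwise) is defined. - $E\,\Phi\cap h\,M_1^1\ldots M_n^1\Rightarrow h\,N_1^1\ldots N_n^1$ if $h:A_1\to^1\cdots A_n\to^1a$ and $\langle\Phi_i\rangle_{A_i}\cap M_i\Rightarrow N_i$ for all $i$, for some labellings $\Phi_1,\ldots,\Phi_n$ of the same variables such that: $\Phi(x)=0$ implies $\Phi_i(x)=0$ for all $i$; $\Phi(x)=u$ implies $\Phi_i(x)=u$ for all $i$; if $\Phi(x)=1$ and $x\ne h$, then $\Phi_i(x)=1$ for exactly one $i$ and $\Phi_j(x)=u$ for all $j\ne i$. If $h$ is a variable, then also $\Phi(h)\neq0$, and $\Phi(h)=1$ implies $\Phi_i(h)=u$ for all $i$. - $h\,M_1^1\ldots M_n^1\cap h\,N_1^1\ldots N_n^1\Rightarrow h\,Q_1^1\ldots Q_n^1$ if $M_i\cap N_i\Rightarrow Q_i$ for all $i$. - $\lambda x^u{:}A.M\cap\lambda x^u{:}A.N\Rightarrow\lambda x^u{:}A.Q$ if $M\cap N\Rightarrow Q$ in $\Psi,x{:}A$. On sets,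 $\mathcal M\cap\mathcal N=\bigcup_{M\in\mathcal M,N\in\mathcal N}M\cap N$ and $\mathrm{Not}(\mathcal M)=\bigcap_{M\in\mathcal M}\mathrm{Not}(M)$, the iterated intersection in some order, ending with $\mathbf 1$ (so that the empty intersection is $\mathbf 1$). Here $\mathbf 0=\emptyset$ and $\mathbf 1=\{\top_A\}$. **Theorem.** $\mathrm{Pat}_A(\Psi)$ contains $\mathbf 0$ and $\mathbf 1$ and is closed under $\cup$, $\cap$ and $\mathrm{Not}$, and for all $\mathcal M,\mathcal N,\mathcal P\in\mathrm{Pat}_A(\Psi)$: 1. $\mathcal M\cap\mathcal M\simeq\mathcal M$; 2. $\mathcal M\cap\mathcal N\simeq\mathcal N\cap\mathcal M$; 3. $\mathcal M\cap(\mathcal N\cup\mathcal P)\simeq(\mathcal M\cap\mathcal N)\cup(\mathcal M\cap\mathcal P)$; 4. $\mathcal M\cap(\mathcal N\cap\mathcal P)\simeq(\mathcal M\cap\mathcal N)\cap\mathcal P$; 5. $\mathrm{Not}(\mathrm{Not}(\mathcal M))\simeq\mathcal M$; 6. $\mathrm{Not}(\mathbf 1)\simeq\mathbf 0$; 7. $\mathrm{Not}(\mathbf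 0)\simeq\mathbf 1$. Moreover $\cup,\cap,\mathrm{Not}$ are well defined on $\simeq$-classes, and $\langle\mathrm{Pat}_A(\Psi)/{\simeq},\cup,\cap,\mathrm{Not},\mathbf 1,\mathbf 0\rangle$ is a Boolean algebra with join $\cup$, meet $\cap$, complement $\mathrm{Not}$, greatest element $\mathbf 1$ and least element $\mathbf 0$ (possibly with $\mathbf 0=\mathbf 1$). -/

import Mathlib

/-! The strict lambda-calculus, simple linear patterns over it, and the complement and
intersection algorithms on these patterns.  Variables are well-scoped de Bruijn indices: a context
`Ψ` with `n` declarations is a map `Fin n → Ty Atom`, and index `0` is the most recent one. -/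

namespace StrictLambda

universe u v

/-- The labels `1` (strict), `0` (invariant, irrelevant) and `u` (undetermined). -/
inductive Label : Type
  | strict
  | vacuous
  | undet

/-- Types of the strict calculus: `A ::= a | A →ᵏ A`. -/
inductive Ty (Atom : Type u) : Type u
  | atom (a : Atom) : Ty Atom
  | arr (k : Label) (A B : Ty Atom) : Ty Atom

/-- Simple types `A ::= a | A → A`. -/
inductive SimpleTy (Atom : Type u) : Type u
  | atom (a : Atom) : SimpleTy Atom
  | arr (A B : SimpleTy Atom) : SimpleTy Atom

mutual
/-- `a⁺ = a` and `(A → B)⁺ = A⁻ →¹ B⁺`. -/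
def SimpleTy.pos {Atom : Type u} : SimpleTy Atom → Ty Atom
  | .atom a => .atom a
  | .arr A B => .arr .strict A.neg B.pos
/-- `a⁻ = a` and `(A → B)⁻ = A⁺ →ᵘ B⁻`. -/
def SimpleTy.neg {Atom : Type u} : SimpleTy Atom → Ty Atom
  | .atom a => .atom a
  | .arr A B => .arr .undet A.pos B.neg
end

/-- The embedding `(·)⁺` of a family of declarations (a signature or a context). -/
def declPos {Atom : Type u} {I : Type v} (D : I → SimpleTy Atom) : I → Ty Atom :=
  fun i => (D i).pos

/-- Terms of the strict calculus (without existential variables) with `n` variables in scope: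
`M ::= c | x | λxᵏ:A. M | M Mᵏ`. -/
inductive Term (Atom : Type u) (Con : Type v) : ℕ → Type (max u v)
  | const {n : ℕ} (c : Con) : Term Atom Con n
  | var {n : ℕ} (i : Fin n) : Term Atom Con n
  | lam {n : ℕ} (k : Label) (A : Ty Atom) (M : Term Atom Con (n + 1)) : Term Atom Con n
  | app {n : ℕ} (M N : Term Atom Con n) (k : Label) : Term Atom Con n

/-! A triple of contexts `Γ; Ω; Δ` is represented by the total context `Ψ = (Γ, Ω, Δ)` together
with a map `z : Fin n → Label`, where `z x` is `u`, `0` or `1` according to whether `x` is declared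
in `Γ`, `Ω` or `Δ`.  In particular `Ψ; ·; ·` is `z = fun _ => undet`. -/

/-- The label of a variable after `Γ; Ω; Δ` has been changed to `(Γ, Δ); Ω; ·`. -/
def Label.loosen : Label → Label
  | .strict => .undet
  | .vacuous => .vacuous
  | .undet => .undet

/-- `z` is `Γ; Ω; (Δ_M, Δ_N)`, `zM` is `(Γ, Δ_N); Ω; Δ_M` and `zN` is `(Γ, Δ_M); Ω; Δ_N`. -/
def Split {n : ℕ} (z zM zN : Fin n → Label) : Prop :=
  ∀ i, (z i = .strict ∧
      ((zM i = .strict ∧ zN i = .undet) ∨ (zM i = .undet ∧ zN i = .strict))) ∨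
    (z i ≠ .strict ∧ zM i = z i ∧ zN i = z i)

/-- The typing judgment `Γ; Ω; Δ ⊢ M : A` over the signature `S`. -/
inductive HasType {Atom : Type u} {Con : Type v} (S : Con → Ty Atom) :
    {n : ℕ} → (Fin n → Ty Atom) → (Fin n → Label) → Term Atom Con n → Ty Atom → Prop
  | con {n : ℕ} {Ψ : Fin n → Ty Atom} {z : Fin n → Label} (c : Con)
      (hz : ∀ i, z i ≠ .strict) : HasType S Ψ z (.const c) (S c)
  | idU {n : ℕ} {Ψ : Fin n → Ty Atom} {z : Fin n → Label} (x : Fin n)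
      (hx : z x = .undet) (hz : ∀ i, z i ≠ .strict) : HasType S Ψ z (.var x) (Ψ x)
  | idS {n : ℕ} {Ψ : Fin n → Ty Atom} {z : Fin n → Label} (x : Fin n)
      (hx : z x = .strict) (hz : ∀ i, i ≠ x → z i ≠ .strict) : HasType S Ψ z (.var x) (Ψ x)
  | lam {n : ℕ} {Ψ : Fin n → Ty Atom} {z : Fin n → Label} {k : Label} {A B : Ty Atom}
      {M : Term Atom Con (n + 1)}
      (hM : HasType S (Fin.cons A Ψ : Fin (n + 1) → Ty Atom)
        (Fin.cons k z : Fin (n + 1) → Label) M B) :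
      HasType S Ψ z (.lam k A M) (.arr k A B)
  | appU {n : ℕ} {Ψ : Fin n → Ty Atom} {z : Fin n → Label} {A B : Ty Atom}
      {M N : Term Atom Con n} (hM : HasType S Ψ z M (.arr .undet A B))
      (hN : HasType S Ψ (fun i => (z i).loosen) N A) :
      HasType S Ψ z (.app M N .undet) B
  | appV {n : ℕ} {Ψ : Fin n → Ty Atom} {z : Fin n → Label} {A B : Ty Atom}
      {M N : Term Atom Con n} (hM : HasType S Ψ z M (.arr .vacuous A B))
      (hN : HasType S Ψ (fun _ => .undet) N A) :
      HasType S Ψ z (.app M N .vacuous) B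
  | appS {n : ℕ} {Ψ : Fin n → Ty Atom} {z zM zN : Fin n → Label} {A B : Ty Atom}
      {M N : Term Atom Con n} (hz : Split z zM zN)
      (hM : HasType S Ψ zM M (.arr .strict A B)) (hN : HasType S Ψ zN N A) :
      HasType S Ψ z (.app M N .strict) B

mutual
/-- The judgment `Γ; Ω; Δ ⊢ M ↓ A` (`M` is atomic of type `A`). -/
inductive Atomic {Atom : Type u} {Con : Type v} (S : Con → Ty Atom) :
    {n : ℕ} → (Fin n → Ty Atom) → (Fin n → Label) → Term Atom Con n → Ty Atom → Prop
  | con {n : ℕ} {Ψ : Fin n → Ty Atom} {z : Fin n → Label} (c : Con)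
      (hz : ∀ i, z i ≠ .strict) : Atomic S Ψ z (.const c) (S c)
  | idU {n : ℕ} {Ψ : Fin n → Ty Atom} {z : Fin n → Label} (x : Fin n)
      (hx : z x = .undet) (hz : ∀ i, z i ≠ .strict) : Atomic S Ψ z (.var x) (Ψ x)
  | idS {n : ℕ} {Ψ : Fin n → Ty Atom} {z : Fin n → Label} (x : Fin n)
      (hx : z x = .strict) (hz : ∀ i, i ≠ x → z i ≠ .strict) : Atomic S Ψ z (.var x) (Ψ x)
  | appU {n : ℕ} {Ψ : Fin n → Ty Atom} {z : Fin n → Label} {A B : Ty Atom}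
      {M N : Term Atom Con n} (hM : Atomic S Ψ z M (.arr .undet A B))
      (hN : Canonical S Ψ (fun i => (z i).loosen) N A) :
      Atomic S Ψ z (.app M N .undet) B
  | appV {n : ℕ} {Ψ : Fin n → Ty Atom} {z : Fin n → Label} {A B : Ty Atom}
      {M N : Term Atom Con n} (hM : Atomic S Ψ z M (.arr .vacuous A B))
      (hN : Canonical S Ψ (fun _ => .undet) N A) :
      Atomic S Ψ z (.app M N .vacuous) B
  | appS {n : ℕ} {Ψ : Fin n → Ty Atom} {z zM zN : Fin n → Label} {A B : Ty Atom}
      {M N : Term Atom Con n} (hz : Split z zM zN)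
      (hM : Atomic S Ψ zM M (.arr .strict A B)) (hN : Canonical S Ψ zN N A) :
      Atomic S Ψ z (.app M N .strict) B
/-- The judgment `Γ; Ω; Δ ⊢ M ⇑ A` (`M` is canonical of type `A`). -/
inductive Canonical {Atom : Type u} {Con : Type v} (S : Con → Ty Atom) :
    {n : ℕ} → (Fin n → Ty Atom) → (Fin n → Label) → Term Atom Con n → Ty Atom → Prop
  | at {n : ℕ} {Ψ : Fin n → Ty Atom} {z : Fin n → Label} {a : Atom} {M : Term Atom Con n}
      (hM : Atomic S Ψ z M (.atom a)) : Canonical S Ψ z M (.atom a)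
  | lam {n : ℕ} {Ψ : Fin n → Ty Atom} {z : Fin n → Label} {k : Label} {A B : Ty Atom}
      {M : Term Atom Con (n + 1)}
      (hM : Canonical S (Fin.cons A Ψ : Fin (n + 1) → Ty Atom)
        (Fin.cons k z : Fin (n + 1) → Label) M B) :
      Canonical S Ψ z (.lam k A M) (.arr k A B)
end

/-- A head `h`: a constant of the signature or a variable in scope. -/
inductive Head (Con : Type v) (n : ℕ) : Type v
  | const (c : Con) : Head Con n
  | var (x : Fin n) : Head Con n

/-- The type assigned to a head by the signature and the context. -/
def Head.ty {Atom : Type u} {Con : Type v} {n : ℕ} (S : Con → Ty Atom) (Ψ : Fin n → Ty Atom) :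
    Head Con n → Ty Atom
  | .const c => S c
  | .var x => Ψ x

/-- A head, as a term. -/
def Head.toTerm (Atom : Type u) {Con : Type v} {n : ℕ} : Head Con n → Term Atom Con n
  | .const c => .const c
  | .var x => .var x

/-- The iterated strict application `M N₁¹ … Nₘ¹`. -/
def Term.apps {Atom : Type u} {Con : Type v} {n : ℕ} (M : Term Atom Con n) :
    {m : ℕ} → (Fin m → Term Atom Con n) → Term Atom Con n
  | 0, _ => M
  | _ + 1, Ns => (Term.app M (Ns 0) .strict).apps (fun i => Ns i.succ)

/-- The type `A₁ →¹ ⋯ →¹ Aₘ →¹ a`. -/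
def Ty.strictArrs {Atom : Type u} : {m : ℕ} → (Fin m → Ty Atom) → Atom → Ty Atom
  | 0, _, a => .atom a
  | _ + 1, As, a => .arr .strict (As 0) (Ty.strictArrs (fun i => As i.succ) a)

/-- Fully applied simple linear patterns, `M ::= λxᵘ:A. M | h M₁¹ … Mₘ¹ | E x₁^k₁ … xₙ^kₙ`.
In `flex a Φ` the existential variable `E` is applied to all `n` variables in scope, in their
standard order, the variable `x` with label `Φ x`, and the result has base type `a` (so that the
type of `E` is determined).  Existential variables have their scope limited to one pattern, and in a
linear pattern each of them occurs exactly once; linear patterns up to the choice of the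
names of their existential variables are thus the same thing as patterns whose existential variables
are anonymous.  All existential variables introduced below are therefore fresh and distinct. -/
inductive Pattern (Atom : Type u) (Con : Type v) : ℕ → Type (max u v)
  | lam {n : ℕ} (A : Ty Atom) (M : Pattern Atom Con (n + 1)) : Pattern Atom Con n
  | rigid {n : ℕ} (h : Head Con n) {m : ℕ} (Ms : Fin m → Pattern Atom Con n) : Pattern Atom Con n
  | flex {n : ℕ} (a : Atom) (Φ : Fin n → Label) : Pattern Atom Con n

/-- The judgment `Ψ ⊢ N ⇑ A` for a pattern `N`. -/
inductive PatCanonical {Atom : Type u} {Con : Type v} (S : Con → Ty Atom) :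
    {n : ℕ} → (Fin n → Ty Atom) → Pattern Atom Con n → Ty Atom → Prop
  | lam {n : ℕ} {Ψ : Fin n → Ty Atom} {A B : Ty Atom} {N : Pattern Atom Con (n + 1)}
      (hN : PatCanonical S (Fin.cons A Ψ : Fin (n + 1) → Ty Atom) N B) :
      PatCanonical S Ψ (.lam A N) (.arr .undet A B)
  | rigid {n : ℕ} {Ψ : Fin n → Ty Atom} {h : Head Con n} {m : ℕ} {As : Fin m → Ty Atom}
      {a : Atom} {Ns : Fin m → Pattern Atom Con n} (hh : h.ty S Ψ = Ty.strictArrs As a)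
      (hN : ∀ i, PatCanonical S Ψ (Ns i) (As i)) :
      PatCanonical S Ψ (.rigid h Ns) (.atom a)
  | flex {n : ℕ} {Ψ : Fin n → Ty Atom} (a : Atom) (Φ : Fin n → Label) :
      PatCanonical S Ψ (.flex a Φ) (.atom a)

/-- The judgment `Ψ ⊢ M ∈ ‖N‖ : A` (for canonical `M`).  In the rule for `E Φ`, the zones
`Γ; Ω; Δ` are those determined by `Φ`. -/
inductive GrInst {Atom : Type u} {Con : Type v} (S : Con → Ty Atom) :
    {n : ℕ} → (Fin n → Ty Atom) → Term Atom Con n → Pattern Atom Con n → Ty Atom → Prop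
  | flex {n : ℕ} {Ψ : Fin n → Ty Atom} {a : Atom} {Φ : Fin n → Label} {M : Term Atom Con n}
      (hM : HasType S Ψ Φ M (.atom a)) : GrInst S Ψ M (.flex a Φ) (.atom a)
  | lam {n : ℕ} {Ψ : Fin n → Ty Atom} {A B : Ty Atom} {M : Term Atom Con (n + 1)}
      {N : Pattern Atom Con (n + 1)}
      (hM : GrInst S (Fin.cons A Ψ : Fin (n + 1) → Ty Atom) M N B) :
      GrInst S Ψ (.lam .undet A M) (.lam A N) (.arr .undet A B)
  | app {n : ℕ} {Ψ : Fin n → Ty Atom} {h : Head Con n} {m : ℕ} {As : Fin m → Ty Atom}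
      {a : Atom} {Ms : Fin m → Term Atom Con n} {Ns : Fin m → Pattern Atom Con n}
      (hh : h.ty S Ψ = Ty.strictArrs As a) (hM : ∀ i, GrInst S Ψ (Ms i) (Ns i) (As i)) :
      GrInst S Ψ ((h.toTerm Atom).apps Ms) (.rigid h Ns) (.atom a)

/-- The eta-expansion `λy₁ᵘ:A₁ … λyₘᵘ:Aₘ. E Φ y₁ᵘ … yₘᵘ` of a generalized variable `E Φ` of type
`A₁ →ᵘ ⋯ →ᵘ Aₘ →ᵘ a`. -/
def Pattern.genVar {Atom : Type u} (Con : Type v) :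
    Ty Atom → {n : ℕ} → (Fin n → Label) → Pattern Atom Con n
  | .atom a, _, Φ => .flex a Φ
  | .arr _ A B, n, Φ =>
      .lam A (Pattern.genVar Con B (Fin.cons .undet Φ : Fin (n + 1) → Label))

/-- The generalized variable `Z Ψᵘ`, which may depend on all variables in scope. -/
def Pattern.top {Atom : Type u} (Con : Type v) (n : ℕ) (A : Ty Atom) : Pattern Atom Con n :=
  Pattern.genVar Con A (fun _ => .undet)

/-- `Not(1) = 0`, `Not(0) = 1`, `Not(u) = u`. -/
def Label.not : Label → Label
  | .strict => .vacuous
  | .vacuous => .strict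
  | .undet => .undet

/-- The complement algorithm `Ψ ⊢ Not(M) ⇒ N : A`. -/
inductive NotStep {Atom : Type u} {Con : Type v} (S : Con → Ty Atom) :
    {n : ℕ} → (Fin n → Ty Atom) → Pattern Atom Con n → Pattern Atom Con n → Ty Atom → Prop
  | flex {n : ℕ} {Ψ : Fin n → Ty Atom} {a : Atom} {Φ : Fin n → Label} (i : Fin n)
      (hi : Φ i ≠ .undet) :
      NotStep S Ψ (.flex a Φ) (.flex a (Function.update (fun _ => .undet) i (Φ i).not)) (.atom a)
  | lam {n : ℕ} {Ψ : Fin n → Ty Atom} {A B : Ty Atom} {M N : Pattern Atom Con (n + 1)}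
      (hM : NotStep S (Fin.cons A Ψ : Fin (n + 1) → Ty Atom) M N B) :
      NotStep S Ψ (.lam A M) (.lam A N) (.arr .undet A B)
  | app₁ {n : ℕ} {Ψ : Fin n → Ty Atom} {h g : Head Con n} {l m : ℕ} {As : Fin m → Ty Atom}
      {a : Atom} {Ms : Fin l → Pattern Atom Con n}
      (hg : g.ty S Ψ = Ty.strictArrs As a) (hne : h ≠ g) :
      NotStep S Ψ (.rigid h Ms) (.rigid g (fun j => Pattern.top Con n (As j))) (.atom a)
  | app₂ {n : ℕ} {Ψ : Fin n → Ty Atom} {h : Head Con n} {m : ℕ} {As : Fin m → Ty Atom}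
      {a : Atom} {Ms : Fin m → Pattern Atom Con n} {N : Pattern Atom Con n}
      (hh : h.ty S Ψ = Ty.strictArrs As a) (i : Fin m) (hN : NotStep S Ψ (Ms i) N (As i)) :
      NotStep S Ψ (.rigid h Ms)
        (.rigid h (Function.update (fun j => Pattern.top Con n (As j)) i N)) (.atom a)

/-- The partial intersection of labels: `1 ∩ 1 = u ∩ 1 = 1 ∩ u = 1`,
`0 ∩ 0 = u ∩ 0 = 0 ∩ u = 0`, `u ∩ u = u`. -/
def Label.inter : Label → Label → Option Label
  | .strict, .strict => some .strict
  | .undet, .strict => some .strict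
  | .strict, .undet => some .strict
  | .vacuous, .vacuous => some .vacuous
  | .undet, .vacuous => some .vacuous
  | .vacuous, .undet => some .vacuous
  | .undet, .undet => some .undet
  | .strict, .vacuous => none
  | .vacuous, .strict => none

/-- The proviso under which `E Φ` is distributed over the `m` arguments of a constant. -/
def DistribConst {n m : ℕ} (Φ : Fin n → Label) (Φs : Fin m → Fin n → Label) : Prop :=
  (∀ x, Φ x = .vacuous → ∀ i, Φs i x = .vacuous) ∧
  (∀ x, Φ x = .undet → ∀ i, Φs i x = .undet) ∧
  (∀ x, Φ x = .strict → ∃ i, Φs i x = .strict ∧ ∀ j, j ≠ i → Φs j x = .undet)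

/-- The proviso under which `E Φ` is distributed over the `m` arguments of a variable `y`.  The
head `y` is an occurrence of `y`, hence `Φ y ≠ 0`, and `Φ y = 1` needs no further occurrence. -/
def DistribVar {n m : ℕ} (y : Fin n) (Φ : Fin n → Label) (Φs : Fin m → Fin n → Label) : Prop :=
  Φ y ≠ .vacuous ∧
  (∀ x, Φ x = .vacuous → ∀ i, Φs i x = .vacuous) ∧
  (∀ x, Φ x = .undet → ∀ i, Φs i x = .undet) ∧
  (∀ x, x ≠ y → Φ x = .strict → ∃ i, Φs i x = .strict ∧ ∀ j, j ≠ i → Φs j x = .undet) ∧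
  (Φ y = .strict → ∀ i, Φs i y = .undet)

/-- The intersection (unification) algorithm `Ψ ⊢ M ∩ N ⇒ Q : A`. -/
inductive InterStep {Atom : Type u} {Con : Type v} (S : Con → Ty Atom) :
    {n : ℕ} → (Fin n → Ty Atom) → Pattern Atom Con n → Pattern Atom Con n →
      Pattern Atom Con n → Ty Atom → Prop
  | flexFlex {n : ℕ} {Ψ : Fin n → Ty Atom} {a : Atom} {Φ₁ Φ₂ Φ : Fin n → Label}
      (hΦ : ∀ x, (Φ₁ x).inter (Φ₂ x) = some (Φ x)) :
      InterStep S Ψ (.flex a Φ₁) (.flex a Φ₂) (.flex a Φ) (.atom a)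
  | flexConst {n : ℕ} {Ψ : Fin n → Ty Atom} {c : Con} {m : ℕ} {As : Fin m → Ty Atom}
      {a : Atom} {Φ : Fin n → Label} {Φs : Fin m → Fin n → Label}
      {Ms Ns : Fin m → Pattern Atom Con n}
      (hc : S c = Ty.strictArrs As a) (hΦ : DistribConst Φ Φs)
      (hM : ∀ i, InterStep S Ψ (Pattern.genVar Con (As i) (Φs i)) (Ms i) (Ns i) (As i)) :
      InterStep S Ψ (.flex a Φ) (.rigid (.const c) Ms) (.rigid (.const c) Ns) (.atom a)
  | flexVar {n : ℕ} {Ψ : Fin n → Ty Atom} {y : Fin n} {m : ℕ} {As : Fin m → Ty Atom}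
      {a : Atom} {Φ : Fin n → Label} {Φs : Fin m → Fin n → Label}
      {Ms Ns : Fin m → Pattern Atom Con n}
      (hy : Ψ y = Ty.strictArrs As a) (hΦ : DistribVar y Φ Φs)
      (hM : ∀ i, InterStep S Ψ (Pattern.genVar Con (As i) (Φs i)) (Ms i) (Ns i) (As i)) :
      InterStep S Ψ (.flex a Φ) (.rigid (.var y) Ms) (.rigid (.var y) Ns) (.atom a)
  | constFlex {n : ℕ} {Ψ : Fin n → Ty Atom} {c : Con} {m : ℕ} {As : Fin m → Ty Atom}
      {a : Atom} {Φ : Fin n → Label} {Φs : Fin m → Fin n → Label}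
      {Ms Ns : Fin m → Pattern Atom Con n}
      (hc : S c = Ty.strictArrs As a) (hΦ : DistribConst Φ Φs)
      (hM : ∀ i, InterStep S Ψ (Ms i) (Pattern.genVar Con (As i) (Φs i)) (Ns i) (As i)) :
      InterStep S Ψ (.rigid (.const c) Ms) (.flex a Φ) (.rigid (.const c) Ns) (.atom a)
  | varFlex {n : ℕ} {Ψ : Fin n → Ty Atom} {y : Fin n} {m : ℕ} {As : Fin m → Ty Atom}
      {a : Atom} {Φ : Fin n → Label} {Φs : Fin m → Fin n → Label}
      {Ms Ns : Fin m → Pattern Atom Con n}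
      (hy : Ψ y = Ty.strictArrs As a) (hΦ : DistribVar y Φ Φs)
      (hM : ∀ i, InterStep S Ψ (Ms i) (Pattern.genVar Con (As i) (Φs i)) (Ns i) (As i)) :
      InterStep S Ψ (.rigid (.var y) Ms) (.flex a Φ) (.rigid (.var y) Ns) (.atom a)
  | rigidRigid {n : ℕ} {Ψ : Fin n → Ty Atom} {h : Head Con n} {m : ℕ} {As : Fin m → Ty Atom}
      {a : Atom} {Ms Ns Qs : Fin m → Pattern Atom Con n}
      (hh : h.ty S Ψ = Ty.strictArrs As a)
      (hM : ∀ i, InterStep S Ψ (Ms i) (Ns i) (Qs i) (As i)) :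
      InterStep S Ψ (.rigid h Ms) (.rigid h Ns) (.rigid h Qs) (.atom a)
  | lam {n : ℕ} {Ψ : Fin n → Ty Atom} {A B : Ty Atom} {M N Q : Pattern Atom Con (n + 1)}
      (hM : InterStep S (Fin.cons A Ψ : Fin (n + 1) → Ty Atom) M N Q B) :
      InterStep S Ψ (.lam A M) (.lam A N) (.lam A Q) (.arr .undet A B)

/-- `Pat_A(Ψ)`: the finite sets of simple linear patterns `N` with `Ψ ⊢ N ⇑ A`. -/
def PatSet {Atom : Type u} {Con : Type v} (S : Con → Ty Atom) {n : ℕ} (Ψ : Fin n → Ty Atom)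
    (A : Ty Atom) : Type (max u v) :=
  {𝓜 : Set (Pattern Atom Con n) // 𝓜.Finite ∧ ∀ N ∈ 𝓜, PatCanonical S Ψ N A}

/-- `‖𝓜‖`: the canonical terms `M` with `Ψ ⊢ M ⇑ A` that are ground instances of a member of `𝓜`. -/
def instances {Atom : Type u} {Con : Type v} (S : Con → Ty Atom) {n : ℕ} (Ψ : Fin n → Ty Atom)
    (A : Ty Atom) (𝓜 : Set (Pattern Atom Con n)) : Set (Term Atom Con n) :=
  {M | Canonical S Ψ (fun _ => .undet) M A ∧ ∃ N ∈ 𝓜, GrInst S Ψ M N A}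

/-- `𝓜 ∩ 𝓝 = ⋃_{M ∈ 𝓜, N ∈ 𝓝} M ∩ N`, where `M ∩ N = {Q | Ψ ⊢ M ∩ N ⇒ Q : A}`. -/
def interSet {Atom : Type u} {Con : Type v} (S : Con → Ty Atom) {n : ℕ} (Ψ : Fin n → Ty Atom)
    (A : Ty Atom) (𝓜 𝓝 : Set (Pattern Atom Con n)) : Set (Pattern Atom Con n) :=
  {Q | ∃ M ∈ 𝓜, ∃ N ∈ 𝓝, InterStep S Ψ M N Q A}

/-- `Not(M) = {N | Ψ ⊢ Not(M) ⇒ N : A}`. -/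
def notPat {Atom : Type u} {Con : Type v} (S : Con → Ty Atom) {n : ℕ} (Ψ : Fin n → Ty Atom)
    (A : Ty Atom) (M : Pattern Atom Con n) : Set (Pattern Atom Con n) :=
  {N | NotStep S Ψ M N A}

/-- `Not(𝓜) = ⋂_{M ∈ 𝓜} Not(M)`: the iterated pattern-set intersection of the sets `Not(M)`, the
members of `𝓜` being taken in an arbitrary order; the empty intersection is `𝟏`. -/
noncomputable def notSet {Atom : Type u} {Con : Type v} {S : Con → Ty Atom} {n : ℕ}
    {Ψ : Fin n → Ty Atom} {A : Ty Atom} (𝓜 : PatSet S Ψ A) : Set (Pattern Atom Con n) :=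
  (𝓜.2.1.toFinset.toList).foldr (fun M 𝓠 => interSet S Ψ A (notPat S Ψ A M) 𝓠)
    {Pattern.top Con n A}

/-- `𝓜 ≃ 𝓝` iff `‖𝓜‖ = ‖𝓝‖`. -/
def patSetoid {Atom : Type u} {Con : Type v} (S : Con → Ty Atom) {n : ℕ} (Ψ : Fin n → Ty Atom)
    (A : Ty Atom) : Setoid (PatSet S Ψ A) where
  r 𝓜 𝓝 := instances S Ψ A 𝓜.1 = instances S Ψ A 𝓝.1
  iseqv := ⟨fun _ => rfl, fun h => h.symm, fun h₁ h₂ => h₁.trans h₂⟩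

/-- `Pat_A(Ψ)` up to `≃`. -/
def PatClass {Atom : Type u} {Con : Type v} (S : Con → Ty Atom) {n : ℕ} (Ψ : Fin n → Ty Atom)
    (A : Ty Atom) : Type (max u v) :=
  Quotient (patSetoid S Ψ A)

/-- The class of a finite set of patterns. -/
def PatSet.cls {Atom : Type u} {Con : Type v} {S : Con → Ty Atom} {n : ℕ} {Ψ : Fin n → Ty Atom}
    {A : Ty Atom} (𝓜 : PatSet S Ψ A) : PatClass S Ψ A :=
  Quotient.mk (patSetoid S Ψ A) 𝓜

/-- `𝓜 ≃ 𝓝` iff `‖𝓜‖ = ‖𝓝‖`. -/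
def PatSet.Equiv {Atom : Type u} {Con : Type v} {S : Con → Ty Atom} {n : ℕ} {Ψ : Fin n → Ty Atom}
    {A : Ty Atom} (𝓜 𝓝 : PatSet S Ψ A) : Prop :=
  instances S Ψ A 𝓜.1 = instances S Ψ A 𝓝.1

end StrictLambda

open StrictLambda

-- Over declarations of the form `B⁺` and at a type of the form `B⁻`, canonical terms have only
-- undetermined abstractions and strict applications, so each is an abstraction or a head applied to
-- a full spine (`Canonical.can`). For such terms the labels merely record occurrence: typing under
-- `z` holds iff every strict variable occurs and no vacuous one does (`Can.hasType_iff`).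
--
-- An instance of `E Φ` is therefore a term satisfying a conjunction of conditions "x occurs" or "x
-- does not occur". Intersecting labels conjoins two such conditions, and is undefined only where
-- they contradict each other. The negation is a disjunction over the labelled variables, each with
-- its label flipped. A condition on a spine distributes over its arguments by choosing, for each
-- strict variable other than the head, an argument in which it occurs. Heads and argument lists are
-- determined by the term, so rigid patterns are treated argument by argument.
--
-- Hence intersection computes the intersection of instance sets (`InterStep.sound`,
-- `Can.inter_complete`) and `Not` their complement within the canonical terms (`Can.not_iff`). Both
-- preserve finiteness and typing. Denotation thus embeds the classes into a powerset, compatibly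
-- with all operations, and the laws and the Boolean structure are pulled back.

namespace StrictLambda

universe u v

-- Spines, argument types, and the two polarities

section Spines

variable {Atom : Type u} {Con : Type v} {n : ℕ}

/-- The head of an iterated application. -/
def Term.hd {n : ℕ} : Term Atom Con n → Term Atom Con n
  | .const c => .const c
  | .var x => .var x
  | .lam k A M => .lam k A M
  | .app M _ _ => M.hd

/-- The arguments of an iterated application. -/
def Term.args {n : ℕ} : Term Atom Con n → List (Term Atom Con n)
  | .const _ => []
  | .var _ => []
  | .lam _ _ _ => []
  | .app M N _ => M.args ++ [N]

theorem Term.hd_apps {m : ℕ} (M : Term Atom Con n) (Ns : Fin m → Term Atom Con n) :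
    (M.apps Ns).hd = M.hd := by
  induction m generalizing M with
  | zero => rfl
  | succ m ih => rw [Term.apps, ih, Term.hd]

theorem Term.args_apps {m : ℕ} (M : Term Atom Con n) (Ns : Fin m → Term Atom Con n) :
    (M.apps Ns).args = M.args ++ List.ofFn Ns := by
  induction m generalizing M with
  | zero => simp [Term.apps]
  | succ m ih => rw [Term.apps, ih, Term.args, List.ofFn_succ]; simp

theorem Head.hd_toTerm (h : Head Con n) : (h.toTerm Atom).hd = h.toTerm Atom := by
  cases h <;> rfl

theorem Head.args_toTerm (h : Head Con n) : (h.toTerm Atom).args = [] := by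
  cases h <;> rfl

theorem Head.toTerm_injective : Function.Injective (Head.toTerm Atom (Con := Con) (n := n)) := by
  intro h h' e
  cases h <;> cases h' <;> simp [Head.toTerm] at e <;> simp [e]

theorem Head.apps_head {h h' : Head Con n} {m m' : ℕ} {Ms : Fin m → Term Atom Con n}
    {Ms' : Fin m' → Term Atom Con n} (e : (h.toTerm Atom).apps Ms = (h'.toTerm Atom).apps Ms') :
    h = h' := by
  have := congrArg Term.hd e
  rw [Term.hd_apps, Term.hd_apps, Head.hd_toTerm, Head.hd_toTerm] at this
  exact Head.toTerm_injective this

/-- The arities are not known to agree beforehand, so arity and arguments are recovered together,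
through the argument list. -/
theorem Head.apps_args {h h' : Head Con n} {m m' : ℕ} {Ms : Fin m → Term Atom Con n}
    {Ms' : Fin m' → Term Atom Con n} (e : (h.toTerm Atom).apps Ms = (h'.toTerm Atom).apps Ms') :
    (⟨m, Ms⟩ : Σ m, Fin m → Term Atom Con n) = ⟨m', Ms'⟩ := by
  have := congrArg Term.args e
  rw [Term.args_apps, Term.args_apps, Head.args_toTerm, Head.args_toTerm] at this
  exact List.ofFn_inj'.1 (by simpa using this)

/-- The argument types of a type. -/
def Ty.dom : Ty Atom → List (Ty Atom)
  | .atom _ => []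
  | .arr _ A B => A :: B.dom

theorem Ty.dom_strictArrs {m : ℕ} (As : Fin m → Ty Atom) (a : Atom) :
    (Ty.strictArrs As a).dom = List.ofFn As := by
  induction m with
  | zero => simp [Ty.strictArrs, Ty.dom]
  | succ m ih => rw [Ty.strictArrs, Ty.dom, ih, List.ofFn_succ]

/-- Two rules that each decompose the type of the same head are matched through this: the type alone
fixes arity and argument types. -/
theorem Ty.strictArrs_dom {m m' : ℕ} {As : Fin m → Ty Atom} {As' : Fin m' → Ty Atom} {a a' : Atom}
    (e : Ty.strictArrs As a = Ty.strictArrs As' a') :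
    (⟨m, As⟩ : Σ m, Fin m → Ty Atom) = ⟨m', As'⟩ := by
  have := congrArg Ty.dom e
  rw [Ty.dom_strictArrs, Ty.dom_strictArrs] at this
  exact List.ofFn_inj'.1 this

theorem Ty.strictArrs_injective {m : ℕ} {As As' : Fin m → Ty Atom} {a a' : Atom}
    (e : Ty.strictArrs As a = Ty.strictArrs As' a') : As = As' := by
  simpa using Ty.strictArrs_dom e

/-- The types of the form `B⁺`. -/
def Ty.IsPos (T : Ty Atom) : Prop := ∃ B : SimpleTy Atom, T = B.pos

/-- The types of the form `B⁻`. -/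
def Ty.IsNeg (T : Ty Atom) : Prop := ∃ B : SimpleTy Atom, T = B.neg

theorem Ty.IsPos.of_arr {k : Label} {A B : Ty Atom} (h : (Ty.arr k A B).IsPos) :
    k = .strict ∧ A.IsNeg ∧ B.IsPos := by
  obtain ⟨_ | ⟨C, D⟩, e⟩ := h
  · simp [SimpleTy.pos] at e
  · rw [SimpleTy.pos] at e
    cases e
    exact ⟨rfl, ⟨_, rfl⟩, ⟨_, rfl⟩⟩

theorem Ty.IsNeg.of_arr {k : Label} {A B : Ty Atom} (h : (Ty.arr k A B).IsNeg) :
    k = .undet ∧ A.IsPos ∧ B.IsNeg := by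
  obtain ⟨_ | ⟨C, D⟩, e⟩ := h
  · simp [SimpleTy.neg] at e
  · rw [SimpleTy.neg] at e
    cases e
    exact ⟨rfl, ⟨_, rfl⟩, ⟨_, rfl⟩⟩

theorem Ty.IsPos.dom {m : ℕ} {As : Fin m → Ty Atom} {a : Atom} (h : (Ty.strictArrs As a).IsPos)
    (i : Fin m) : (As i).IsNeg := by
  induction m with
  | zero => exact i.elim0
  | succ m ih =>
    have h' := Ty.IsPos.of_arr h
    exact Fin.cases h'.2.1 (fun j => ih h'.2.2 j) i

theorem Ty.IsPos.cons {Ψ : Fin n → Ty Atom} {A : Ty Atom} (hA : A.IsPos) (hΨ : ∀ i, (Ψ i).IsPos) :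
    ∀ i, ((Fin.cons A Ψ : Fin (n + 1) → Ty Atom) i).IsPos :=
  Fin.cases hA hΨ

theorem Head.isPos {S : Con → Ty Atom} {Ψ : Fin n → Ty Atom} (hS : ∀ c, (S c).IsPos)
    (hΨ : ∀ i, (Ψ i).IsPos) (h : Head Con n) : (h.ty S Ψ).IsPos := by
  cases h
  · exact hS _
  · exact hΨ _

end Spines

-- Canonical terms in spine form

section Canonical

variable {Atom : Type u} {Con : Type v} {S : Con → Ty Atom}

/-- Canonical terms in which every abstraction is undetermined and every application strict, in
spine form. -/
inductive Can (S : Con → Ty Atom) :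
    {n : ℕ} → (Fin n → Ty Atom) → Term Atom Con n → Ty Atom → Prop
  | lam {n : ℕ} {Ψ : Fin n → Ty Atom} {A B : Ty Atom} {M : Term Atom Con (n + 1)}
      (hM : Can S (Fin.cons A Ψ : Fin (n + 1) → Ty Atom) M B) :
      Can S Ψ (.lam .undet A M) (.arr .undet A B)
  | app {n : ℕ} {Ψ : Fin n → Ty Atom} {h : Head Con n} {m : ℕ} {As : Fin m → Ty Atom}
      {a : Atom} {Ms : Fin m → Term Atom Con n} (hh : h.ty S Ψ = Ty.strictArrs As a)
      (hM : ∀ i, Can S Ψ (Ms i) (As i)) : Can S Ψ ((h.toTerm Atom).apps Ms) (.atom a)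

theorem Split.undet {n : ℕ} {z zM zN : Fin n → Label} (h : Split z zM zN)
    (hz : z = fun _ => .undet) : (zM = fun _ => .undet) ∧ (zN = fun _ => .undet) := by
  subst hz
  constructor <;> funext i <;> have := h i <;> simp at this <;> simp [this]

theorem cons_undet {n : ℕ} : (Fin.cons Label.undet (fun _ => .undet) : Fin (n + 1) → Label) =
    fun _ => .undet := by
  funext i
  refine Fin.cases rfl (fun j => rfl) i

/-- Heads have positive types and the codomain of a positive arrow is positive. Since positive
arrows are strict, this rules out undetermined and vacuous applications. -/
theorem Atomic.isPos (hS : ∀ c, (S c).IsPos) {n : ℕ} {Ψ : Fin n → Ty Atom}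
    {z : Fin n → Label} {M : Term Atom Con n} {T : Ty Atom} (hΨ : ∀ i, (Ψ i).IsPos)
    (hM : Atomic S Ψ z M T) : T.IsPos := by
  induction M generalizing T with
  | const c => cases hM; exact hS c
  | var x => cases hM <;> exact hΨ x
  | lam => cases hM
  | app M N k ihM _ => cases hM with
    | appU hM _ => exact (ihM hΨ hM).of_arr.2.2
    | appV hM _ => exact (ihM hΨ hM).of_arr.2.2
    | appS _ hM _ => exact (ihM hΨ hM).of_arr.2.2

/-- Applications nest to the left while `Can` exposes the head, so the motive for atomic terms
carries the arguments still to be applied on the right. -/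
theorem Canonical.can_aux (hS : ∀ c, (S c).IsPos) {n : ℕ} {Ψ : Fin n → Ty Atom}
    {z : Fin n → Label} {M : Term Atom Con n} {A : Ty Atom} (hM : Canonical S Ψ z M A) :
    (∀ i, (Ψ i).IsPos) → (z = fun _ => .undet) → A.IsNeg → Can S Ψ M A := by
  refine Canonical.rec (S := S)
    (motive_1 := fun {n} Ψ z M T _ => (∀ i, (Ψ i).IsPos) → (z = fun _ => .undet) →
      ∀ (m : ℕ) (As : Fin m → Ty Atom) (a : Atom) (Ms : Fin m → Term Atom Con n),
        T = Ty.strictArrs As a → (∀ i, Can S Ψ (Ms i) (As i)) → Can S Ψ (M.apps Ms) (.atom a))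
    (motive_2 := fun Ψ z M A _ => (∀ i, (Ψ i).IsPos) → (z = fun _ => .undet) → A.IsNeg →
      Can S Ψ M A) ?_ ?_ ?_ ?_ ?_ ?_ ?_ ?_ hM
  · intro n Ψ z c _ _ _ m As a Ms e hMs
    exact Can.app (h := .const c) e hMs
  · intro n Ψ z x _ _ _ _ m As a Ms e hMs
    exact Can.app (h := .var x) e hMs
  · intro n Ψ z x _ _ _ _ m As a Ms e hMs
    exact Can.app (h := .var x) e hMs
  · intro n Ψ z A B M N hM _ _ _ hΨ
    cases (Atomic.isPos hS hΨ hM).of_arr.1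
  · intro n Ψ z A B M N hM _ _ _ hΨ
    cases (Atomic.isPos hS hΨ hM).of_arr.1
  · intro n Ψ z zM zN A B M N hz hM _ ihM ihN hΨ hz' m As a Ms e hMs
    obtain ⟨h1, h2⟩ := hz.undet hz'
    have hA := (Atomic.isPos hS hΨ hM).of_arr.2.1
    -- The argument `N` joins the front of the pending spine.
    refine ihM hΨ h1 (m + 1) (Fin.cons A As) a (Fin.cons N Ms) ?_ ?_
    · simp [Ty.strictArrs, e]
    · exact Fin.cases (ihN hΨ h2 hA) hMs
  · intro n Ψ z a M _ ih hΨ hz _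
    exact ih hΨ hz 0 Fin.elim0 a Fin.elim0 rfl (fun i => i.elim0)
  · intro n Ψ z k A B M _ ih hΨ hz hA
    obtain ⟨rfl, hA, hB⟩ := hA.of_arr
    subst hz
    exact Can.lam (ih (hA.cons hΨ) cons_undet hB)

theorem Canonical.can (hS : ∀ c, (S c).IsPos) {n : ℕ} {Ψ : Fin n → Ty Atom}
    {M : Term Atom Con n} {A : Ty Atom} (hΨ : ∀ i, (Ψ i).IsPos) (hA : A.IsNeg)
    (hM : Canonical S Ψ (fun _ => .undet) M A) : Can S Ψ M A :=
  hM.can_aux hS hΨ rfl hA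

end Canonical

-- Labels as occurrence conditions

section Occurrences

variable {Atom : Type u} {Con : Type v} {S : Con → Ty Atom}

/-- The variable `x` occurs in `M`. -/
def Term.Occ : {n : ℕ} → Term Atom Con n → Fin n → Prop
  | _, .const _, _ => False
  | _, .var y, x => x = y
  | _, .lam _ _ M, x => M.Occ x.succ
  | _, .app M N _, x => M.Occ x ∨ N.Occ x

/-- Every abstraction in `M` is undetermined and every application strict. -/
def Term.Plain : {n : ℕ} → Term Atom Con n → Prop
  | _, .const _ => True
  | _, .var _ => True
  | _, .lam k _ M => k = .undet ∧ M.Plain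
  | _, .app M N k => k = .strict ∧ M.Plain ∧ N.Plain

/-- The strict variables of `z` occur in `M`, and the vacuous ones do not. -/
def Term.Good {n : ℕ} (z : Fin n → Label) (M : Term Atom Con n) : Prop :=
  ∀ x, (z x = .strict → M.Occ x) ∧ (z x = .vacuous → ¬ M.Occ x)

theorem Term.good_undet {n : ℕ} (M : Term Atom Con n) : M.Good (fun _ => .undet) := by
  intro x; simp

theorem Term.good_lam {n : ℕ} {z : Fin n → Label} {k : Label} {A : Ty Atom}
    {M : Term Atom Con (n + 1)} :
    (Term.lam k A M).Good z ↔ M.Good (Fin.cons .undet z : Fin (n + 1) → Label) := by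
  constructor
  · intro h
    exact Fin.cases (by simp) h
  · intro h x
    exact h x.succ

theorem Term.occ_apps {n m : ℕ} (M : Term Atom Con n) (Ns : Fin m → Term Atom Con n) (x : Fin n) :
    (M.apps Ns).Occ x ↔ M.Occ x ∨ ∃ i, (Ns i).Occ x := by
  induction m generalizing M with
  | zero => simp [Term.apps]
  | succ m ih => rw [Term.apps, ih, Term.Occ, Fin.exists_fin_succ, or_assoc]

theorem Term.plain_apps {n m : ℕ} {M : Term Atom Con n} {Ns : Fin m → Term Atom Con n}
    (hM : M.Plain) (hN : ∀ i, (Ns i).Plain) : (M.apps Ns).Plain := by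
  induction m generalizing M with
  | zero => exact hM
  | succ m ih => exact ih ⟨rfl, hM, hN 0⟩ (fun i => hN i.succ)

theorem Can.plain {n : ℕ} {Ψ : Fin n → Ty Atom} {M : Term Atom Con n} {A : Ty Atom}
    (hM : Can S Ψ M A) : M.Plain := by
  induction hM with
  | lam _ ih => exact ⟨rfl, ih⟩
  | @app n Ψ h _ _ _ _ _ _ ih => exact Term.plain_apps (by cases h <;> trivial) ih

/-- A split hands each strict variable to one side, where it must occur by induction. Plainness
matters because an irrelevant variable may occur in the argument of a vacuous application. -/
theorem HasType.good {n : ℕ} {Ψ : Fin n → Ty Atom} {z : Fin n → Label} {M : Term Atom Con n}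
    {A : Ty Atom} (hM : HasType S Ψ z M A) (hp : M.Plain) : M.Good z := by
  induction hM with
  | con c hz => exact fun x => ⟨fun h => absurd h (hz x), fun _ h => h⟩
  | idU y hy hz =>
    refine fun x => ⟨fun h => absurd h (hz x), fun h e => ?_⟩
    rw [show x = y from e, hy] at h
    cases h
  | idS y hy hz =>
    refine fun x => ⟨fun h => ?_, fun h e => ?_⟩
    · by_contra e
      exact hz x e h
    · rw [show x = y from e, hy] at h
      cases h
  | lam hM ih =>
    obtain ⟨rfl, hp⟩ := hp
    exact Term.good_lam.2 (ih hp)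
  | appU => cases hp.1
  | appV => cases hp.1
  | appS hz _ _ ihM ihN =>
    intro x
    have h1 := ihM hp.2.1 x
    have h2 := ihN hp.2.2 x
    have h3 := hz x
    simp only [Term.Occ]
    grind

theorem HasType.app_of_good {n : ℕ} {Ψ : Fin n → Ty Atom} {M N : Term Atom Con n} {A B : Ty Atom}
    (hM : ∀ z, M.Good z → HasType S Ψ z M (.arr .strict A B))
    (hN : ∀ z, N.Good z → HasType S Ψ z N A) (z : Fin n → Label)
    (h : (Term.app M N .strict).Good z) : HasType S Ψ z (.app M N .strict) B := by
  classical
  -- A strict variable is given to `M` if it occurs there, and otherwise to `N`, where it must then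
  -- occur.
  refine HasType.appS (zM := fun x => if z x = .strict then if M.Occ x then .strict else .undet
      else z x)
    (zN := fun x => if z x = .strict then if M.Occ x then .undet else .strict else z x) ?_
    (hM _ ?_) (hN _ ?_)
  · intro x
    by_cases hx : z x = .strict <;> by_cases hx' : M.Occ x <;> simp [hx, hx']
  all_goals
    intro x
    have := h x
    simp only [Term.Occ] at this
    by_cases hx : z x = .strict <;> by_cases hx' : M.Occ x <;> simp [hx, hx'] <;> grind

theorem HasType.apps_of_good {n : ℕ} {Ψ : Fin n → Ty Atom} {m : ℕ} {a : Atom} {M : Term Atom Con n}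
    {Ns : Fin m → Term Atom Con n} {As : Fin m → Ty Atom}
    (hM : ∀ z, M.Good z → HasType S Ψ z M (Ty.strictArrs As a))
    (hN : ∀ i z, (Ns i).Good z → HasType S Ψ z (Ns i) (As i)) (z : Fin n → Label)
    (h : (M.apps Ns).Good z) : HasType S Ψ z (M.apps Ns) (.atom a) := by
  induction m generalizing M with
  | zero => exact hM z h
  | succ m ih =>
    exact ih (HasType.app_of_good hM (hN 0)) (fun i => hN i.succ) h

theorem Head.hasType_of_good {n : ℕ} {Ψ : Fin n → Ty Atom} (h : Head Con n) (z : Fin n → Label)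
    (hz : (h.toTerm Atom).Good z) : HasType S Ψ z (h.toTerm Atom) (h.ty S Ψ) := by
  cases h with
  | const c => exact .con c (fun i hi => (hz i).1 hi)
  | var x =>
    have h1 : ∀ i, i ≠ x → z i ≠ .strict := fun i hi e => hi ((hz i).1 e)
    rcases e : z x with _ | _ | _
    · exact .idS x e h1
    · exact absurd rfl ((hz x).2 e)
    · refine .idU x e fun i hi => ?_
      by_cases hix : i = x
      · rw [hix, e] at hi; cases hi
      · exact h1 i hix hi

/-- The bridge from typing to occurrences: once a term is canonical, relabelling the context only
imposes occurrence conditions. -/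
theorem Can.hasType_iff {n : ℕ} {Ψ : Fin n → Ty Atom} {M : Term Atom Con n} {A : Ty Atom}
    (hM : Can S Ψ M A) (z : Fin n → Label) : HasType S Ψ z M A ↔ M.Good z := by
  refine ⟨fun h => h.good hM.plain, ?_⟩
  induction hM with
  | lam _ ih => exact fun h => .lam (ih _ (Term.good_lam.1 h))
  | @app n Ψ h _ _ _ _ hh _ ih =>
    exact HasType.apps_of_good (hh ▸ h.hasType_of_good) ih z

/-- The proviso under which `E Φ` is distributed over the arguments of a head. -/
def Distrib {n m : ℕ} : Head Con n → (Fin n → Label) → (Fin m → Fin n → Label) → Prop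
  | .const _, Φ, Φs => DistribConst Φ Φs
  | .var y, Φ, Φs => DistribVar y Φ Φs

theorem Distrib.good {n m : ℕ} {h : Head Con n} {Φ : Fin n → Label} {Φs : Fin m → Fin n → Label}
    (hΦ : Distrib h Φ Φs) {Ms : Fin m → Term Atom Con n} (hM : ∀ i, (Ms i).Good (Φs i)) :
    ((h.toTerm Atom).apps Ms).Good Φ := by
  intro x
  rw [Term.occ_apps]
  cases h with
  | const c =>
    obtain ⟨h0, -, h1⟩ := hΦ
    simp only [Head.toTerm, Term.Occ, false_or]
    refine ⟨fun hx => ?_, ?_⟩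
    · obtain ⟨i, hi, -⟩ := h1 x hx
      exact ⟨i, (hM i x).1 hi⟩
    · rintro hx ⟨i, hi⟩
      exact (hM i x).2 (h0 x hx i) hi
  | var y =>
    obtain ⟨hy, h0, -, h1, -⟩ := hΦ
    simp only [Head.toTerm, Term.Occ]
    refine ⟨fun hx => ?_, ?_⟩
    · by_cases hxy : x = y
      · exact .inl hxy
      · obtain ⟨i, hi, -⟩ := h1 x hxy hx
        exact .inr ⟨i, (hM i x).1 hi⟩
    · rintro hx (rfl | ⟨i, hi⟩)
      · exact hy hx
      · exact (hM i x).2 (h0 x hx i) hi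

/-- Converse of `Distrib.good`. A strict variable other than the head occurs in some argument; that
one is labelled strict and the others are left undetermined. Different terms may need different
choices, which is why the algorithm branches. -/
theorem Distrib.exists_of_good {n m : ℕ} {h : Head Con n} {Φ : Fin n → Label}
    {Ms : Fin m → Term Atom Con n} (hM : ((h.toTerm Atom).apps Ms).Good Φ) :
    ∃ Φs : Fin m → Fin n → Label, Distrib h Φ Φs ∧ ∀ i, (Ms i).Good (Φs i) := by
  classical
  -- The proviso treats variables independently, so the labels of a single `x` across all arguments
  -- can be chosen first and then assembled.
  have key : ∀ x, ∃ f : Fin m → Label, (Φ x = .vacuous → ∀ i, f i = .vacuous) ∧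
      (Φ x = .undet → ∀ i, f i = .undet) ∧
      (¬ (h.toTerm Atom).Occ x → Φ x = .strict → ∃ i, f i = .strict ∧ ∀ j, j ≠ i → f j = .undet) ∧
      ((h.toTerm Atom).Occ x → Φ x = .strict → ∀ i, f i = .undet) ∧
      ∀ i, (f i = .strict → (Ms i).Occ x) ∧ (f i = .vacuous → ¬ (Ms i).Occ x) := by
    intro x
    have hx := hM x
    rw [Term.occ_apps] at hx
    rcases e : Φ x with _ | _ | _
    · by_cases ho : (h.toTerm Atom).Occ x
      · exact ⟨fun _ => .undet, by simp [ho]⟩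
      · obtain ⟨i, hi⟩ := (hx.1 e).resolve_left ho
        refine ⟨fun j => if j = i then .strict else .undet, by simp, by simp,
          fun _ _ => ⟨i, by simp, fun j hj => by simp [hj]⟩, by simp [ho], fun j => ?_⟩
        by_cases hj : j = i <;> simp [hj, hi]
    · have := hx.2 e
      refine ⟨fun _ => .vacuous, by simp, by simp, by simp, by simp, fun i => ⟨by simp, fun _ hi =>
        this (.inr ⟨i, hi⟩)⟩⟩
    · exact ⟨fun _ => .undet, by simp⟩
  choose f h0 hu h1 h2 hg using key
  refine ⟨fun i x => f x i, ?_, fun i x => hg x i⟩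
  cases h with
  | const c => exact ⟨h0, hu, fun x => h1 x (fun e => e)⟩
  | var y =>
    refine ⟨fun e => (hM y).2 e ((Term.occ_apps _ _ _).2 (.inl rfl)), h0, hu, fun x hx => h1 x hx,
      h2 y rfl⟩

end Occurrences
-- Correctness of intersection and complement on ground instances
section Instances

variable {Atom : Type u} {Con : Type v} {S : Con → Ty Atom}

theorem GrInst.of_flex {n : ℕ} {Ψ : Fin n → Ty Atom} {M : Term Atom Con n} {a : Atom}
    {Φ : Fin n → Label} {T : Ty Atom} (H : GrInst S Ψ M (.flex a Φ) T) :
    T = .atom a ∧ HasType S Ψ Φ M (.atom a) := by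
  cases H; exact ⟨rfl, ‹_›⟩

theorem GrInst.of_lam {n : ℕ} {Ψ : Fin n → Ty Atom} {A T : Ty Atom} {M : Term Atom Con n}
    {N : Pattern Atom Con (n + 1)} (H : GrInst S Ψ M (.lam A N) T) :
    ∃ M' B, M = .lam .undet A M' ∧ T = .arr .undet A B ∧
      GrInst S (Fin.cons A Ψ : Fin (n + 1) → Ty Atom) M' N B := by
  cases H; exact ⟨_, _, rfl, rfl, ‹_›⟩

theorem GrInst.of_arr {n : ℕ} {Ψ : Fin n → Ty Atom} {A B : Ty Atom} {M : Term Atom Con n}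
    {P : Pattern Atom Con n} (H : GrInst S Ψ M P (.arr .undet A B)) :
    ∃ M' N, M = .lam .undet A M' ∧ P = .lam A N ∧
      GrInst S (Fin.cons A Ψ : Fin (n + 1) → Ty Atom) M' N B := by
  cases H; exact ⟨_, _, rfl, rfl, ‹_›⟩

theorem GrInst.lam_iff {n : ℕ} {Ψ : Fin n → Ty Atom} {A B : Ty Atom} {M : Term Atom Con (n + 1)}
    {N : Pattern Atom Con (n + 1)} :
    GrInst S Ψ (.lam .undet A M) (.lam A N) (.arr .undet A B) ↔
      GrInst S (Fin.cons A Ψ : Fin (n + 1) → Ty Atom) M N B := by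
  refine ⟨fun H => ?_, .lam⟩
  obtain ⟨M', B', e, e', h⟩ := H.of_lam
  cases e
  cases e'
  exact h

theorem Can.of_arr {n : ℕ} {Ψ : Fin n → Ty Atom} {A B : Ty Atom} {M : Term Atom Con n}
    (H : Can S Ψ M (.arr .undet A B)) :
    ∃ M', M = .lam .undet A M' ∧ Can S (Fin.cons A Ψ : Fin (n + 1) → Ty Atom) M' B := by
  cases H; exact ⟨_, rfl, ‹_›⟩

/-- The variables bound by the eta-expansion are undetermined and impose no condition, so only `Φ`
remains at the base type. -/
theorem Can.grInst_genVar_iff {n : ℕ} {Ψ : Fin n → Ty Atom} {M : Term Atom Con n} {A : Ty Atom}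
    (hM : Can S Ψ M A) (Φ : Fin n → Label) :
    GrInst S Ψ M (Pattern.genVar Con A Φ) A ↔ M.Good Φ := by
  induction hM with
  | lam hM ih =>
    rw [Term.good_lam, ← ih, Pattern.genVar]
    exact GrInst.lam_iff
  | app hh hM ih =>
    rw [← (Can.app hh hM).hasType_iff, Pattern.genVar]
    exact ⟨fun h => h.of_flex.2, .flex⟩

theorem Can.grInst_flex_iff {n : ℕ} {Ψ : Fin n → Ty Atom} {M : Term Atom Con n} {a : Atom}
    (hM : Can S Ψ M (.atom a)) (Φ : Fin n → Label) :
    GrInst S Ψ M (.flex a Φ) (.atom a) ↔ M.Good Φ :=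
  hM.grInst_genVar_iff Φ

theorem Can.grInst_top {n : ℕ} {Ψ : Fin n → Ty Atom} {M : Term Atom Con n} {A : Ty Atom}
    (hM : Can S Ψ M A) : GrInst S Ψ M (Pattern.top Con n A) A :=
  (hM.grInst_genVar_iff _).2 M.good_undet

theorem GrInst.rigid_inv {n : ℕ} {Ψ : Fin n → Ty Atom} {h h' : Head Con n} {m m' : ℕ}
    {As : Fin m → Ty Atom} {a : Atom} {Ms : Fin m → Term Atom Con n}
    {Ns : Fin m' → Pattern Atom Con n} (hh : h.ty S Ψ = Ty.strictArrs As a)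
    (H : GrInst S Ψ ((h.toTerm Atom).apps Ms) (.rigid h' Ns) (.atom a)) :
    h' = h ∧ ∃ Ns' : Fin m → Pattern Atom Con n,
      (⟨m', Ns⟩ : Σ m, Fin m → Pattern Atom Con n) = ⟨m, Ns'⟩ ∧
      ∀ i, GrInst S Ψ (Ms i) (Ns' i) (As i) := by
  generalize e : (h.toTerm Atom).apps Ms = M at H
  cases H with
  | app hh' hM =>
    obtain rfl := Head.apps_head e
    obtain ⟨rfl, e'⟩ := Sigma.mk.inj_iff.1 (Head.apps_args e)
    cases e'
    obtain rfl := Ty.strictArrs_injective (hh.symm.trans hh')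
    exact ⟨rfl, Ns, rfl, hM⟩

theorem GrInst.rigid_iff {n : ℕ} {Ψ : Fin n → Ty Atom} {h : Head Con n} {m : ℕ}
    {As : Fin m → Ty Atom} {a : Atom} {Ms : Fin m → Term Atom Con n}
    {Ns : Fin m → Pattern Atom Con n} (hh : h.ty S Ψ = Ty.strictArrs As a) :
    GrInst S Ψ ((h.toTerm Atom).apps Ms) (.rigid h Ns) (.atom a) ↔
      ∀ i, GrInst S Ψ (Ms i) (Ns i) (As i) := by
  refine ⟨fun H => ?_, .app hh⟩
  obtain ⟨-, Ns', e, hN⟩ := H.rigid_inv hh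
  cases e
  exact hN

/-- A canonical instance of a rigid pattern is an application of its head. -/
theorem Can.rigid_inv {n : ℕ} {Ψ : Fin n → Ty Atom} {h : Head Con n} {m : ℕ}
    {As : Fin m → Ty Atom} {a : Atom} {M : Term Atom Con n}
    {Ns : Fin m → Pattern Atom Con n} (hM : Can S Ψ M (.atom a))
    (hh : h.ty S Ψ = Ty.strictArrs As a) (H : GrInst S Ψ M (.rigid h Ns) (.atom a)) :
    ∃ Ms : Fin m → Term Atom Con n, M = (h.toTerm Atom).apps Ms ∧ (∀ i, Can S Ψ (Ms i) (As i)) ∧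
      ∀ i, GrInst S Ψ (Ms i) (Ns i) (As i) := by
  cases hM with
  | app hh' hMs =>
    obtain ⟨rfl, Ns', e, hN⟩ := H.rigid_inv hh'
    cases e
    obtain rfl := Ty.strictArrs_injective (hh.symm.trans hh')
    exact ⟨_, rfl, hMs, hN⟩

theorem Label.inter_strict {k l r : Label} (h : k.inter l = some r) :
    r = .strict ↔ k = .strict ∨ l = .strict := by
  cases k <;> cases l <;> cases r <;> simp [Label.inter] at h ⊢

theorem Label.inter_vacuous {k l r : Label} (h : k.inter l = some r) :
    r = .vacuous ↔ k = .vacuous ∨ l = .vacuous := by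
  cases k <;> cases l <;> cases r <;> simp [Label.inter] at h ⊢

theorem Label.inter_comm (k l : Label) : k.inter l = l.inter k := by
  cases k <;> cases l <;> rfl

theorem Term.good_inter {n : ℕ} {M : Term Atom Con n} {Φ₁ Φ₂ Φ : Fin n → Label}
    (hΦ : ∀ x, (Φ₁ x).inter (Φ₂ x) = some (Φ x)) : M.Good Φ ↔ M.Good Φ₁ ∧ M.Good Φ₂ := by
  simp only [Term.Good, Label.inter_strict (hΦ _), Label.inter_vacuous (hΦ _)]
  grind

/-- Label intersection fails only on strict against vacuous, and no variable both occurs and does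
not occur in `M`. -/
theorem Term.exists_inter {n : ℕ} {M : Term Atom Con n} {Φ₁ Φ₂ : Fin n → Label}
    (h₁ : M.Good Φ₁) (h₂ : M.Good Φ₂) :
    ∃ Φ : Fin n → Label, ∀ x, (Φ₁ x).inter (Φ₂ x) = some (Φ x) := by
  have key : ∀ x, ∃ r, (Φ₁ x).inter (Φ₂ x) = some r := by
    intro x
    have h1 := h₁ x
    have h2 := h₂ x
    cases e1 : Φ₁ x <;> cases e2 : Φ₂ x <;> simp_all [Label.inter]
  choose Φ hΦ using key
  exact ⟨Φ, hΦ⟩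

theorem InterStep.symm {n : ℕ} {Ψ : Fin n → Ty Atom} {P N Q : Pattern Atom Con n} {A : Ty Atom}
    (H : InterStep S Ψ P N Q A) : InterStep S Ψ N P Q A := by
  induction H with
  | flexFlex hΦ => exact .flexFlex fun x => (Label.inter_comm _ _).trans (hΦ x)
  | flexConst hc hΦ _ ih => exact .constFlex hc hΦ ih
  | flexVar hc hΦ _ ih => exact .varFlex hc hΦ ih
  | constFlex hc hΦ _ ih => exact .flexConst hc hΦ ih
  | varFlex hc hΦ _ ih => exact .flexVar hc hΦ ih
  | rigidRigid hh _ ih => exact .rigidRigid hh ih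
  | lam _ ih => exact .lam ih

theorem InterStep.flexRigid {n : ℕ} {Ψ : Fin n → Ty Atom} {h : Head Con n} {m : ℕ}
    {As : Fin m → Ty Atom} {a : Atom} {Φ : Fin n → Label} {Φs : Fin m → Fin n → Label}
    {Ms Ns : Fin m → Pattern Atom Con n} (hh : h.ty S Ψ = Ty.strictArrs As a)
    (hΦ : Distrib h Φ Φs)
    (hM : ∀ i, InterStep S Ψ (Pattern.genVar Con (As i) (Φs i)) (Ms i) (Ns i) (As i)) :
    InterStep S Ψ (.flex a Φ) (.rigid h Ms) (.rigid h Ns) (.atom a) := by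
  cases h with
  | const c => exact .flexConst hh hΦ hM
  | var y => exact .flexVar hh hΦ hM

/-- Common core of soundness for the four rules that mix a generalized variable with a rigid
pattern. -/
theorem Can.of_flexRigid {n : ℕ} {Ψ : Fin n → Ty Atom} {h : Head Con n} {m : ℕ}
    {As : Fin m → Ty Atom} {a : Atom} {Φ : Fin n → Label} {Φs : Fin m → Fin n → Label}
    {Ps Ns : Fin m → Pattern Atom Con n} (hh : h.ty S Ψ = Ty.strictArrs As a)
    (hΦ : Distrib h Φ Φs)
    (ih : ∀ i (M : Term Atom Con n), Can S Ψ M (As i) → GrInst S Ψ M (Ns i) (As i) →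
      GrInst S Ψ M (Pattern.genVar Con (As i) (Φs i)) (As i) ∧ GrInst S Ψ M (Ps i) (As i))
    {M : Term Atom Con n} (hM : Can S Ψ M (.atom a))
    (H : GrInst S Ψ M (.rigid h Ns) (.atom a)) :
    GrInst S Ψ M (.flex a Φ) (.atom a) ∧ GrInst S Ψ M (.rigid h Ps) (.atom a) := by
  rw [hM.grInst_flex_iff]
  obtain ⟨Ms, rfl, hMs, hN⟩ := hM.rigid_inv hh H
  exact ⟨hΦ.good fun i => ((hMs i).grInst_genVar_iff _).1 (ih i _ (hMs i) (hN i)).1,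
    .app hh fun i => (ih i _ (hMs i) (hN i)).2⟩

theorem InterStep.sound {n : ℕ} {Ψ : Fin n → Ty Atom} {P N Q : Pattern Atom Con n} {A : Ty Atom}
    (H : InterStep S Ψ P N Q A) (M : Term Atom Con n) (hM : Can S Ψ M A) :
    GrInst S Ψ M Q A → GrInst S Ψ M P A ∧ GrInst S Ψ M N A := by
  induction H with
  | flexFlex hΦ =>
    simp only [hM.grInst_flex_iff]
    exact (Term.good_inter hΦ).1
  | @flexConst _ _ c _ _ _ _ _ _ _ hc hΦ _ ih =>
    exact Can.of_flexRigid (h := .const c) hc hΦ ih hM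
  | @flexVar _ _ y _ _ _ _ _ _ _ hy hΦ _ ih =>
    exact Can.of_flexRigid (h := .var y) hy hΦ ih hM
  | @constFlex _ _ c _ _ _ _ _ _ _ hc hΦ _ ih =>
    exact fun H => (Can.of_flexRigid (h := .const c) hc hΦ
      (fun i M hM H => (ih i M hM H).symm) hM H).symm
  | @varFlex _ _ y _ _ _ _ _ _ _ hy hΦ _ ih =>
    exact fun H => (Can.of_flexRigid (h := .var y) hy hΦ
      (fun i M hM H => (ih i M hM H).symm) hM H).symm
  | rigidRigid hh _ ih =>
    intro H
    obtain ⟨Ms, rfl, hMs, hN⟩ := hM.rigid_inv hh H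
    exact ⟨.app hh fun i => (ih i _ (hMs i) (hN i)).1, .app hh fun i => (ih i _ (hMs i) (hN i)).2⟩
  | lam _ ih =>
    obtain ⟨M', rfl, hM'⟩ := hM.of_arr
    simp only [GrInst.lam_iff]
    exact ih _ hM'

/-- The induction is on the ground term: a mixed rule replaces `E Φ` by new generalized variables,
which are not subpatterns, whereas the arguments of the term do get smaller. -/
theorem Can.inter_complete {n : ℕ} {Ψ : Fin n → Ty Atom} {M : Term Atom Con n} {A : Ty Atom}
    (hM : Can S Ψ M A) {P N : Pattern Atom Con n} (hP : GrInst S Ψ M P A)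
    (hN : GrInst S Ψ M N A) : ∃ Q, InterStep S Ψ P N Q A ∧ GrInst S Ψ M Q A := by
  induction hM with
  | lam _ ih =>
    obtain ⟨_, P, e, rfl, hP⟩ := hP.of_arr
    cases e
    obtain ⟨_, N, e, rfl, hN⟩ := hN.of_arr
    cases e
    obtain ⟨Q, h1, h2⟩ := ih hP hN
    exact ⟨_, .lam h1, .lam h2⟩
  | @app n Ψ h m As a Ms hh hMs ih =>
    have hM := Can.app hh hMs
    -- The term itself dictates which distribution of `Φ` to follow.
    have mixed : ∀ {Φ : Fin n → Label} {Ns : Fin m → Pattern Atom Con n},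
        ((h.toTerm Atom).apps Ms).Good Φ → (∀ i, GrInst S Ψ (Ms i) (Ns i) (As i)) →
        ∃ Q, InterStep S Ψ (.flex a Φ) (.rigid h Ns) Q (.atom a) ∧
          GrInst S Ψ ((h.toTerm Atom).apps Ms) Q (.atom a) := by
      intro Φ Ns hΦ hN
      obtain ⟨Φs, hd, hg⟩ := Distrib.exists_of_good hΦ
      choose Qs h1 h2 using fun i =>
        ih i (((hMs i).grInst_genVar_iff (Φs i)).2 (hg i)) (hN i)
      exact ⟨_, .flexRigid hh hd h1, .app hh h2⟩
    rcases P with _ | ⟨h', Ps⟩ | ⟨b, Φ⟩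
    · obtain ⟨_, _, _, e, _⟩ := hP.of_lam; cases e
    · obtain ⟨rfl, Ps, e, hP'⟩ := hP.rigid_inv hh
      cases e
      rcases N with _ | ⟨h', Ns⟩ | ⟨b, Φ⟩
      · obtain ⟨_, _, _, e, _⟩ := hN.of_lam; cases e
      · obtain ⟨rfl, Ns, e, hN'⟩ := hN.rigid_inv hh
        cases e
        choose Qs h1 h2 using fun i => ih i (hP' i) (hN' i)
        exact ⟨_, .rigidRigid hh h1, .app hh h2⟩
      · obtain rfl : a = b := by cases hN.of_flex.1; rfl
        obtain ⟨Q, h1, h2⟩ := mixed ((hM.grInst_flex_iff _).1 hN) hP'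
        exact ⟨Q, h1.symm, h2⟩
    · obtain rfl : a = b := by cases hP.of_flex.1; rfl
      rw [hM.grInst_flex_iff] at hP
      rcases N with _ | ⟨h', Ns⟩ | ⟨b, Φ'⟩
      · obtain ⟨_, _, _, e, _⟩ := hN.of_lam; cases e
      · obtain ⟨rfl, Ns, e, hN'⟩ := hN.rigid_inv hh
        cases e
        exact mixed hP hN'
      · obtain rfl : a = b := by cases hN.of_flex.1; rfl
        rw [hM.grInst_flex_iff] at hN
        obtain ⟨Φ'', hΦ⟩ := Term.exists_inter hP hN
        exact ⟨_, .flexFlex hΦ, (hM.grInst_flex_iff _).2 ((Term.good_inter hΦ).2 ⟨hP, hN⟩)⟩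

/-- A conjunction of occurrence conditions fails iff one conjunct does, and the flipped label at
that variable expresses its negation. -/
theorem Term.good_not_iff {n : ℕ} {M : Term Atom Con n} {Φ : Fin n → Label} :
    ¬ M.Good Φ ↔ ∃ i, Φ i ≠ .undet ∧
      M.Good (Function.update (fun _ => .undet) i (Φ i).not) := by
  have key : ∀ i, M.Good (Function.update (fun _ => .undet) i (Φ i).not) ↔
      ((Φ i).not = .strict → M.Occ i) ∧ ((Φ i).not = .vacuous → ¬ M.Occ i) := by
    intro i
    refine ⟨fun h => by simpa using h i, fun h x => ?_⟩
    by_cases hx : x = i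
    · subst hx; simpa using h
    · simp [hx]
  rw [Term.Good, not_forall]
  refine exists_congr fun i => ?_
  rw [key]
  cases Φ i <;> simp [Label.not]

/-- A spine fails to match a rigid pattern iff the heads differ or some argument fails to match,
which are the two application rules. Typing of `P` excludes a mismatch of arity under the same head.
-/
theorem Can.not_iff {n : ℕ} {Ψ : Fin n → Ty Atom} {M : Term Atom Con n} {A : Ty Atom}
    (hM : Can S Ψ M A) {P : Pattern Atom Con n} (hP : PatCanonical S Ψ P A) :
    (∃ Q, NotStep S Ψ P Q A ∧ GrInst S Ψ M Q A) ↔ ¬ GrInst S Ψ M P A := by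
  induction hM with
  | lam _ ih =>
    cases hP with
    | lam hP =>
      rw [GrInst.lam_iff, ← ih hP]
      constructor
      · rintro ⟨_, ⟨⟩, h⟩
        exact ⟨_, ‹_›, GrInst.lam_iff.1 h⟩
      · rintro ⟨Q, h1, h2⟩
        exact ⟨_, .lam h1, .lam h2⟩
  | @app n Ψ h m As a Ms hh hMs ih =>
    have hM := Can.app hh hMs
    cases hP with
    | flex _ Φ =>
      rw [hM.grInst_flex_iff, Term.good_not_iff]
      constructor
      · rintro ⟨_, ⟨i, hi⟩, h⟩
        exact ⟨i, hi, (hM.grInst_flex_iff _).1 h⟩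
      · rintro ⟨i, hi, h⟩
        exact ⟨_, .flex i hi, (hM.grInst_flex_iff _).2 h⟩
    | @rigid _ _ h' m' As' _ Ps hh' hP =>
      constructor
      · rintro ⟨_, H, hQ⟩ hP'
        obtain ⟨rfl, Ps', e, hPs⟩ := hP'.rigid_inv hh
        cases e
        cases H with
        | app₁ hg hne => exact hne (hQ.rigid_inv hh).1.symm
        | @app₂ _ _ _ _ As'' _ _ N hh'' i hN =>
          obtain rfl := Ty.strictArrs_injective (hh.symm.trans hh'')
          obtain rfl := Ty.strictArrs_injective (hh.symm.trans hh')
          have := (GrInst.rigid_iff hh).1 hQ i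
          rw [Function.update_self] at this
          exact (ih i (hP i)).1 ⟨N, hN, this⟩ (hPs i)
      · intro H
        by_cases e : h' = h
        · subst e
          obtain ⟨rfl, e⟩ := Sigma.mk.inj_iff.1 (Ty.strictArrs_dom (hh.symm.trans hh'))
          cases e
          rw [GrInst.rigid_iff hh, not_forall] at H
          obtain ⟨i, hi⟩ := H
          obtain ⟨Q, h1, h2⟩ := (ih i (hP i)).2 hi
          refine ⟨_, .app₂ hh i h1, .app hh fun j => ?_⟩
          by_cases hj : j = i
          · subst hj; rwa [Function.update_self]
          · rw [Function.update_of_ne hj]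
            exact (hMs j).grInst_top
        · exact ⟨_, .app₁ hh e, .app hh fun j => (hMs j).grInst_top⟩

end Instances

-- Typing and finiteness of the outputs

section Closure

variable {Atom : Type u} {Con : Type v} {S : Con → Ty Atom}

/-- `Pattern.genVar` ignores arrow labels and always abstracts with `u`; negativity makes all these
labels `u`. -/
theorem Ty.IsNeg.patCanonical_genVar {A : Ty Atom} (hA : A.IsNeg) {n : ℕ} (Ψ : Fin n → Ty Atom)
    (Φ : Fin n → Label) : PatCanonical S Ψ (Pattern.genVar Con A Φ) A := by
  induction A generalizing n with
  | atom a => exact .flex a Φ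
  | arr k A B _ ih =>
    obtain ⟨rfl, -, hB⟩ := hA.of_arr
    exact .lam (ih hB _ _)

theorem InterStep.patCanonical {n : ℕ} {Ψ : Fin n → Ty Atom} {P N Q : Pattern Atom Con n}
    {A : Ty Atom} (H : InterStep S Ψ P N Q A) : PatCanonical S Ψ Q A := by
  induction H with
  | flexFlex hΦ => exact .flex _ _
  | @flexConst _ _ c _ _ _ _ _ _ _ hc _ _ ih => exact .rigid (h := .const c) hc ih
  | @flexVar _ _ y _ _ _ _ _ _ _ hc _ _ ih => exact .rigid (h := .var y) hc ih
  | @constFlex _ _ c _ _ _ _ _ _ _ hc _ _ ih => exact .rigid (h := .const c) hc ih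
  | @varFlex _ _ y _ _ _ _ _ _ _ hc _ _ ih => exact .rigid (h := .var y) hc ih
  | rigidRigid hh _ ih => exact .rigid hh ih
  | lam _ ih => exact .lam ih

theorem NotStep.patCanonical {n : ℕ} {Ψ : Fin n → Ty Atom} {P Q : Pattern Atom Con n}
    {A : Ty Atom} (H : NotStep S Ψ P Q A) (hS : ∀ c, (S c).IsPos) (hΨ : ∀ i, (Ψ i).IsPos)
    (hA : A.IsNeg) : PatCanonical S Ψ Q A := by
  induction H with
  | flex i hi => exact .flex _ _
  | lam _ ih =>
    obtain ⟨-, hA, hB⟩ := hA.of_arr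
    exact .lam (ih (hA.cons hΨ) hB)
  | @app₁ _ _ _ g _ _ _ _ _ hg _ =>
    exact .rigid hg fun j => ((hg ▸ g.isPos hS hΨ).dom j).patCanonical_genVar _ _
  | @app₂ _ _ h _ _ _ _ _ hh i _ ih =>
    have hneg := (hh ▸ h.isPos hS hΨ : (Ty.strictArrs _ _).IsPos).dom
    refine .rigid hh fun j => ?_
    by_cases hj : j = i
    · subst hj
      rw [Function.update_self]
      exact ih hΨ (hneg j)
    · rw [Function.update_of_ne hj]
      exact (hneg j).patCanonical_genVar _ _

instance : Finite Label :=
  Finite.of_injective (fun | .strict => 0 | .vacuous => 1 | .undet => 2 : Label → Fin 3)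
    (by intro k l; cases k <;> cases l <;> simp)

instance {n : ℕ} [Finite Con] : Finite (Head Con n) :=
  Finite.of_surjective (fun | .inl c => .const c | .inr x => .var x : Con ⊕ Fin n → Head Con n) (by
    rintro (c | x)
    · exact ⟨.inl c, rfl⟩
    · exact ⟨.inr x, rfl⟩)

theorem finite_rigid {n m : ℕ} (h : Head Con n) {s : Fin m → Set (Pattern Atom Con n)}
    (hs : ∀ i, (s i).Finite) :
    {Q | ∃ Ns : Fin m → Pattern Atom Con n, (∀ i, Ns i ∈ s i) ∧
      Q = Pattern.rigid h Ns}.Finite := by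
  refine ((Set.Finite.pi hs).image (Pattern.rigid h)).subset ?_
  rintro _ ⟨Ns, hN, rfl⟩
  exact ⟨Ns, fun i _ => hN i, rfl⟩

/-- Isolated from `InterStep.finite` because the mixed rules recurse on generalized variables with
new labellings: the induction is on `N`, for all `Φ` at once. -/
theorem InterStep.finite_genVar {n : ℕ} {Ψ : Fin n → Ty Atom} {N : Pattern Atom Con n} {A : Ty Atom}
    (hN : PatCanonical S Ψ N A) (Φ : Fin n → Label) :
    {Q | InterStep S Ψ (Pattern.genVar Con A Φ) N Q A}.Finite := by
  induction hN with
  | @lam _ _ A _ _ _ ih =>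
    refine ((ih (Fin.cons .undet Φ)).image (Pattern.lam A)).subset ?_
    rintro _ ⟨⟩
    exact ⟨_, ‹_›, rfl⟩
  | flex a Φ' =>
    refine (Set.finite_range (Pattern.flex a)).subset ?_
    rintro _ ⟨⟩
    exact ⟨_, rfl⟩
  | @rigid n Ψ h m As a Ns hh _ ih =>
    -- The proviso is dropped: there are only finitely many labellings in all.
    refine (Set.finite_iUnion fun Φs : Fin m → Fin n → Label =>
      finite_rigid h fun i => ih i (Φs i)).subset ?_
    rintro _ H
    rw [Set.mem_iUnion]
    generalize e : Pattern.genVar Con (.atom a) Φ = P at H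
    cases H with
    | @flexConst _ _ c _ As' _ _ Φs _ Qs hc hΦ hM =>
      obtain rfl := Ty.strictArrs_injective (hh.symm.trans hc)
      exact ⟨Φs, Qs, hM, rfl⟩
    | @flexVar _ _ c _ As' _ _ Φs _ Qs hc hΦ hM =>
      obtain rfl := Ty.strictArrs_injective (hh.symm.trans hc)
      exact ⟨Φs, Qs, hM, rfl⟩
    | rigidRigid => cases e

theorem InterStep.finite {n : ℕ} {Ψ : Fin n → Ty Atom} {P N : Pattern Atom Con n} {A : Ty Atom}
    (hP : PatCanonical S Ψ P A) (hN : PatCanonical S Ψ N A) :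
    {Q | InterStep S Ψ P N Q A}.Finite := by
  induction hP with
  | @lam _ _ A _ _ _ ih =>
    cases hN with
    | lam hN =>
      refine ((ih hN).image (Pattern.lam A)).subset ?_
      rintro _ ⟨⟩
      exact ⟨_, ‹_›, rfl⟩
  | flex a Φ => exact finite_genVar hN Φ
  | @rigid n Ψ h m As a Ps hh hPs ih =>
    cases hN with
    | flex _ Φ =>
      exact (finite_genVar (PatCanonical.rigid hh hPs) Φ).subset fun Q H => H.symm
    | @rigid _ _ h' m' As' _ Ns hh' hNs =>
      by_cases e : h' = h
      · subst e
        obtain ⟨rfl, e⟩ := Sigma.mk.inj_iff.1 (Ty.strictArrs_dom (hh.symm.trans hh'))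
        cases e
        refine (finite_rigid h' fun i => ih i (hNs i)).subset ?_
        rintro _ H
        cases H with
        | rigidRigid hh'' hM =>
          obtain rfl := Ty.strictArrs_injective (hh.symm.trans hh'')
          exact ⟨_, hM, rfl⟩
      · refine Set.finite_empty.subset ?_
        rintro _ ⟨⟩
        exact e rfl

theorem NotStep.finite [Finite Con] {n : ℕ} {Ψ : Fin n → Ty Atom} {P : Pattern Atom Con n}
    {A : Ty Atom} (hP : PatCanonical S Ψ P A) : {Q | NotStep S Ψ P Q A}.Finite := by
  induction hP with
  | @lam _ _ A _ _ _ ih =>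
    refine (ih.image (Pattern.lam A)).subset ?_
    rintro _ ⟨⟩
    exact ⟨_, ‹_›, rfl⟩
  | flex a Φ =>
    refine (Set.finite_range (Pattern.flex a)).subset ?_
    rintro _ ⟨⟩
    exact ⟨_, rfl⟩
  | @rigid n Ψ h m As a Ns hh _ ih =>
    -- A head contributes at most one pattern, since its type fixes the arguments. Finiteness of the
    -- signature then bounds the union over heads.
    have h₁ : ∀ g : Head Con n, {Q : Pattern Atom Con n | ∃ (k : ℕ) (Bs : Fin k → Ty Atom),
        g.ty S Ψ = Ty.strictArrs Bs a ∧
        Q = .rigid g (fun j => Pattern.top Con n (Bs j))}.Finite := by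
      intro g
      refine Set.Subsingleton.finite ?_
      rintro _ ⟨k, Bs, hB, rfl⟩ _ ⟨k', Bs', hB', rfl⟩
      obtain ⟨rfl, e⟩ := Sigma.mk.inj_iff.1 (Ty.strictArrs_dom (hB.symm.trans hB'))
      cases e
      rfl
    refine ((Set.finite_iUnion h₁).union (Set.finite_iUnion fun i => (ih i).image fun N =>
      Pattern.rigid h (Function.update (fun j => Pattern.top Con n (As j)) i N))).subset ?_
    rintro _ H
    cases H with
    | app₁ hg hne => exact .inl (Set.mem_iUnion.2 ⟨_, _, _, hg, rfl⟩)
    | app₂ hh' i hN =>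
      obtain rfl := Ty.strictArrs_injective (hh.symm.trans hh')
      exact .inr (Set.mem_iUnion.2 ⟨i, _, hN, rfl⟩)

end Closure

-- Pattern sets and their denotations

section PatternSets

variable {Atom : Type u} {Con : Type v} {S : Con → Ty Atom} {n : ℕ} {Ψ : Fin n → Ty Atom}
  {A : Ty Atom}

/-- The property that defines `Pat_A(Ψ)`. -/
def IsPatSet (S : Con → Ty Atom) (Ψ : Fin n → Ty Atom) (A : Ty Atom)
    (𝓜 : Set (Pattern Atom Con n)) : Prop :=
  𝓜.Finite ∧ ∀ N ∈ 𝓜, PatCanonical S Ψ N A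

theorem IsPatSet.empty : IsPatSet S Ψ A ∅ :=
  ⟨Set.finite_empty, fun _ h => h.elim⟩

theorem IsPatSet.top (hA : A.IsNeg) : IsPatSet S Ψ A {Pattern.top Con n A} :=
  ⟨Set.finite_singleton _, by rintro _ rfl; exact hA.patCanonical_genVar _ _⟩

theorem IsPatSet.union {𝓜 𝓝 : Set (Pattern Atom Con n)} (h𝓜 : IsPatSet S Ψ A 𝓜)
    (h𝓝 : IsPatSet S Ψ A 𝓝) : IsPatSet S Ψ A (𝓜 ∪ 𝓝) :=
  ⟨h𝓜.1.union h𝓝.1, fun N h => h.elim (h𝓜.2 N) (h𝓝.2 N)⟩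

theorem IsPatSet.inter {𝓜 𝓝 : Set (Pattern Atom Con n)} (h𝓜 : IsPatSet S Ψ A 𝓜)
    (h𝓝 : IsPatSet S Ψ A 𝓝) : IsPatSet S Ψ A (interSet S Ψ A 𝓜 𝓝) := by
  refine ⟨(h𝓜.1.biUnion fun P hP => h𝓝.1.biUnion fun N hN =>
    InterStep.finite (h𝓜.2 P hP) (h𝓝.2 N hN)).subset ?_, ?_⟩
  · rintro Q ⟨P, hP, N, hN, H⟩
    simp only [Set.mem_iUnion]
    exact ⟨P, hP, N, hN, H⟩
  · rintro Q ⟨P, hP, N, hN, H⟩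
    exact H.patCanonical

theorem IsPatSet.notPat [Finite Con] (hS : ∀ c, (S c).IsPos) (hΨ : ∀ i, (Ψ i).IsPos) (hA : A.IsNeg)
    {P : Pattern Atom Con n} (hP : PatCanonical S Ψ P A) : IsPatSet S Ψ A (notPat S Ψ A P) :=
  ⟨NotStep.finite hP, fun _ H => H.patCanonical hS hΨ hA⟩

theorem IsPatSet.notSet [Finite Con] (hS : ∀ c, (S c).IsPos) (hΨ : ∀ i, (Ψ i).IsPos)
    (hA : A.IsNeg) (𝓜 : PatSet S Ψ A) : IsPatSet S Ψ A (notSet 𝓜) := by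
  have key : ∀ l : List (Pattern Atom Con n), (∀ P ∈ l, PatCanonical S Ψ P A) →
      IsPatSet S Ψ A (l.foldr (fun M 𝓠 => interSet S Ψ A (StrictLambda.notPat S Ψ A M) 𝓠)
        {Pattern.top Con n A}) := by
    intro l hl
    induction l with
    | nil => exact IsPatSet.top hA
    | cons P l ih =>
      rw [List.forall_mem_cons] at hl
      exact (IsPatSet.notPat hS hΨ hA hl.1).inter (ih hl.2)
  exact key _ fun P hP => 𝓜.2.2 P (by simpa using hP)

/-- The canonical terms `M` with `Ψ ⊢ M ⇑ A`. -/
abbrev Ground (S : Con → Ty Atom) (Ψ : Fin n → Ty Atom) (A : Ty Atom) : Type (max u v) :=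
  {M : Term Atom Con n // Canonical S Ψ (fun _ => .undet) M A}

/-- The ground instances of a set of patterns, as a set of canonical terms. -/
def denote (S : Con → Ty Atom) (Ψ : Fin n → Ty Atom) (A : Ty Atom)
    (𝓜 : Set (Pattern Atom Con n)) : Set (Ground S Ψ A) :=
  {M | ∃ N ∈ 𝓜, GrInst S Ψ M.1 N A}

theorem image_denote (𝓜 : Set (Pattern Atom Con n)) :
    Subtype.val '' denote S Ψ A 𝓜 = instances S Ψ A 𝓜 := by
  ext M
  constructor
  · rintro ⟨M, hM, rfl⟩
    exact ⟨M.2, hM⟩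
  · rintro ⟨hM, h⟩
    exact ⟨⟨M, hM⟩, h, rfl⟩

/-- Passing to subsets of `Ground` makes the set complement relative to the canonical terms, as
`Not` requires. -/
theorem instances_eq_iff {𝓜 𝓝 : Set (Pattern Atom Con n)} :
    instances S Ψ A 𝓜 = instances S Ψ A 𝓝 ↔ denote S Ψ A 𝓜 = denote S Ψ A 𝓝 := by
  rw [← image_denote, ← image_denote, Set.image_eq_image Subtype.val_injective]

theorem denote_empty : denote S Ψ A ∅ = ∅ := by
  ext M; simp [denote]

theorem denote_union (𝓜 𝓝 : Set (Pattern Atom Con n)) :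
    denote S Ψ A (𝓜 ∪ 𝓝) = denote S Ψ A 𝓜 ∪ denote S Ψ A 𝓝 := by
  ext M; simp [denote, or_and_right, exists_or]

theorem denote_top (hcan : ∀ M : Ground S Ψ A, Can S Ψ M.1 A) :
    denote S Ψ A {Pattern.top Con n A} = Set.univ := by
  ext M; simpa [denote] using (hcan M).grInst_top

theorem denote_inter (hcan : ∀ M : Ground S Ψ A, Can S Ψ M.1 A) (𝓜 𝓝 : Set (Pattern Atom Con n)) :
    denote S Ψ A (interSet S Ψ A 𝓜 𝓝) = denote S Ψ A 𝓜 ∩ denote S Ψ A 𝓝 := by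
  ext M
  constructor
  · rintro ⟨Q, ⟨P, hP, N, hN, H⟩, hQ⟩
    obtain ⟨h1, h2⟩ := H.sound _ (hcan M) hQ
    exact ⟨⟨P, hP, h1⟩, ⟨N, hN, h2⟩⟩
  · rintro ⟨⟨P, hP, h1⟩, ⟨N, hN, h2⟩⟩
    obtain ⟨Q, H, hQ⟩ := (hcan M).inter_complete h1 h2
    exact ⟨Q, ⟨P, hP, N, hN, H⟩, hQ⟩

/-- De Morgan: the fold denotes the terms matching no listed pattern, a condition that does not
depend on the order of the list. -/
theorem denote_notSet (hcan : ∀ M : Ground S Ψ A, Can S Ψ M.1 A) (𝓜 : PatSet S Ψ A) :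
    denote S Ψ A (notSet 𝓜) = (denote S Ψ A 𝓜.1)ᶜ := by
  have key : ∀ l : List (Pattern Atom Con n), (∀ P ∈ l, PatCanonical S Ψ P A) →
      ∀ M, M ∈ denote S Ψ A (l.foldr (fun M 𝓠 => interSet S Ψ A (StrictLambda.notPat S Ψ A M) 𝓠)
        {Pattern.top Con n A}) ↔ ∀ P ∈ l, ¬ GrInst S Ψ M.1 P A := by
    intro l hl M
    induction l with
    | nil => simp [denote_top hcan]
    | cons P l ih =>
      rw [List.forall_mem_cons] at hl
      rw [List.foldr_cons, denote_inter hcan, List.forall_mem_cons, Set.mem_inter_iff, ih hl.2,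
        ← (hcan M).not_iff hl.1]
      rfl
  ext M
  refine (key _ (fun P hP => 𝓜.2.2 P (by simpa using hP)) M).trans ?_
  simp [denote]

/-- The denotation of a class of finite sets of patterns. -/
def PatClass.denote : PatClass S Ψ A → Set (Ground S Ψ A) :=
  Quotient.lift (fun 𝓜 => StrictLambda.denote S Ψ A 𝓜.1) fun _ _ h => instances_eq_iff.1 h

theorem PatClass.denote_injective :
    Function.Injective (PatClass.denote (S := S) (Ψ := Ψ) (A := A)) := by
  rintro ⟨𝓜⟩ ⟨𝓝⟩ h
  exact Quotient.sound (instances_eq_iff.2 h)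

end PatternSets

end StrictLambda

-- The Boolean algebra of pattern sets

open StrictLambda
theorem mainTheorem3 {Atom Con : Type*} [Finite Con] (sig : Con → SimpleTy Atom) {n : ℕ}
    (ctx : Fin n → SimpleTy Atom) (A : SimpleTy Atom) :
    ∃ (cup cap : PatSet (declPos sig) (declPos ctx) A.neg →
          PatSet (declPos sig) (declPos ctx) A.neg → PatSet (declPos sig) (declPos ctx) A.neg)
      (neg : PatSet (declPos sig) (declPos ctx) A.neg → PatSet (declPos sig) (declPos ctx) A.neg)
      (one zero : PatSet (declPos sig) (declPos ctx) A.neg),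
      -- the operations of the algebra (`Pat_A(Ψ)` is closed under them)
      (∀ 𝓜 𝓝, (cup 𝓜 𝓝).1 = 𝓜.1 ∪ 𝓝.1) ∧
      (∀ 𝓜 𝓝, (cap 𝓜 𝓝).1 = interSet (declPos sig) (declPos ctx) A.neg 𝓜.1 𝓝.1) ∧
      (∀ 𝓜, (neg 𝓜).1 = notSet 𝓜) ∧
      one.1 = {Pattern.top Con n A.neg} ∧
      zero.1 = ∅ ∧
      -- the laws
      (∀ 𝓜, (cap 𝓜 𝓜).Equiv 𝓜) ∧
      (∀ 𝓜 𝓝, (cap 𝓜 𝓝).Equiv (cap 𝓝 𝓜)) ∧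
      (∀ 𝓜 𝓝 𝓟, (cap 𝓜 (cup 𝓝 𝓟)).Equiv (cup (cap 𝓜 𝓝) (cap 𝓜 𝓟))) ∧
      (∀ 𝓜 𝓝 𝓟, (cap 𝓜 (cap 𝓝 𝓟)).Equiv (cap (cap 𝓜 𝓝) 𝓟)) ∧
      (∀ 𝓜, (neg (neg 𝓜)).Equiv 𝓜) ∧
      (neg one).Equiv zero ∧
      (neg zero).Equiv one ∧
      -- up to `≃`, the algebra is Boolean
      ∃ _inst : BooleanAlgebra (PatClass (declPos sig) (declPos ctx) A.neg),
        (∀ 𝓜 𝓝, 𝓜.cls ⊔ 𝓝.cls = (cup 𝓜 𝓝).cls) ∧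
        (∀ 𝓜 𝓝, 𝓜.cls ⊓ 𝓝.cls = (cap 𝓜 𝓝).cls) ∧
        (∀ 𝓜, (𝓜.cls)ᶜ = (neg 𝓜).cls) ∧
        (⊤ : PatClass (declPos sig) (declPos ctx) A.neg) = one.cls ∧
        (⊥ : PatClass (declPos sig) (declPos ctx) A.neg) = zero.cls := by
  have hS : ∀ c, (declPos sig c).IsPos := fun c => ⟨_, rfl⟩
  have hΨ : ∀ i, (declPos ctx i).IsPos := fun i => ⟨_, rfl⟩
  have hA : A.neg.IsNeg := ⟨_, rfl⟩
  -- From here only the polarities of the types matter, not the simple types behind them.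
  generalize declPos sig = S at *
  generalize declPos ctx = Ψ at *
  generalize A.neg = A at *
  have hcan : ∀ M : Ground S Ψ A, Can S Ψ M.1 A := fun M => M.2.can hS hΨ hA
  let cup : PatSet S Ψ A → PatSet S Ψ A → PatSet S Ψ A :=
    fun 𝓜 𝓝 => ⟨𝓜.1 ∪ 𝓝.1, IsPatSet.union 𝓜.2 𝓝.2⟩
  let cap : PatSet S Ψ A → PatSet S Ψ A → PatSet S Ψ A :=
    fun 𝓜 𝓝 => ⟨interSet S Ψ A 𝓜.1 𝓝.1, IsPatSet.inter 𝓜.2 𝓝.2⟩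
  let neg : PatSet S Ψ A → PatSet S Ψ A := fun 𝓜 => ⟨notSet 𝓜, IsPatSet.notSet hS hΨ hA 𝓜⟩
  let one : PatSet S Ψ A := ⟨{Pattern.top Con n A}, IsPatSet.top hA⟩
  let zero : PatSet S Ψ A := ⟨∅, IsPatSet.empty⟩
  let d : PatSet S Ψ A → Set (Ground S Ψ A) := fun 𝓜 => denote S Ψ A 𝓜.1
  have dcup : ∀ 𝓜 𝓝, d (cup 𝓜 𝓝) = d 𝓜 ∪ d 𝓝 := fun 𝓜 𝓝 => denote_union _ _
  have dcap : ∀ 𝓜 𝓝, d (cap 𝓜 𝓝) = d 𝓜 ∩ d 𝓝 := fun 𝓜 𝓝 => denote_inter hcan _ _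
  have dneg : ∀ 𝓜, d (neg 𝓜) = (d 𝓜)ᶜ := fun 𝓜 => denote_notSet hcan 𝓜
  have done : d one = Set.univ := denote_top hcan
  have dzero : d zero = ∅ := denote_empty
  have equiv : ∀ {𝓜 𝓝 : PatSet S Ψ A}, d 𝓜 = d 𝓝 → 𝓜.Equiv 𝓝 := fun h => instances_eq_iff.2 h
  have cls : ∀ {𝓜 𝓝 : PatSet S Ψ A}, d 𝓜 = d 𝓝 → 𝓜.cls = 𝓝.cls := fun h =>
    PatClass.denote_injective h
  refine ⟨cup, cap, neg, one, zero, fun _ _ => rfl, fun _ _ => rfl, fun _ => rfl, rfl, rfl,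
    fun 𝓜 => equiv ?_, fun 𝓜 𝓝 => equiv ?_, fun 𝓜 𝓝 𝓟 => equiv ?_, fun 𝓜 𝓝 𝓟 => equiv ?_,
    fun 𝓜 => equiv ?_, equiv ?_, equiv ?_, ?_⟩
  · rw [dcap, Set.inter_self]
  · rw [dcap, dcap, Set.inter_comm]
  · rw [dcap, dcup, dcup, dcap, dcap, Set.inter_union_distrib_left]
  · rw [dcap, dcap, dcap, dcap, Set.inter_assoc]
  · rw [dneg, dneg, compl_compl]
  · rw [dneg, done, dzero, Set.compl_univ]
  · rw [dneg, done, dzero, Set.compl_empty]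
  · let e : PatClass S Ψ A → Set (Ground S Ψ A) := PatClass.denote
    let C := PatClass S Ψ A
    -- Each operation on classes is chosen through its denotation. Injectivity of `e` makes the
    -- choice unique, so the operations on sets of patterns respect `≃` and agree with the chosen
    -- ones.
    have sup : ∀ x y : C, ∃ z : C, e z = e x ∪ e y := by
      rintro ⟨𝓜⟩ ⟨𝓝⟩; exact ⟨(cup 𝓜 𝓝).cls, dcup 𝓜 𝓝⟩
    have inf : ∀ x y : C, ∃ z : C, e z = e x ∩ e y := by
      rintro ⟨𝓜⟩ ⟨𝓝⟩; exact ⟨(cap 𝓜 𝓝).cls, dcap 𝓜 𝓝⟩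
    have compl : ∀ x : C, ∃ z : C, e z = (e x)ᶜ := by
      rintro ⟨𝓜⟩; exact ⟨(neg 𝓜).cls, dneg 𝓜⟩
    choose sup hsup using sup
    choose inf hinf using inf
    choose compl hcompl using compl
    let : LE C := ⟨fun x y => e x ≤ e y⟩
    let : LT C := ⟨fun x y => e x < e y⟩
    let : Max C := ⟨sup⟩
    let : Min C := ⟨inf⟩
    let : Top C := ⟨one.cls⟩
    let : Bot C := ⟨zero.cls⟩
    let : Compl C := ⟨compl⟩
    -- Difference and implication are not among the given operations; their Boolean definitions are
    -- used so that `e` preserves them too.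
    let : SDiff C := ⟨fun x y => inf x (compl y)⟩
    let : HImp C := ⟨fun x y => sup y (compl x)⟩
    let inst : BooleanAlgebra C := Function.Injective.booleanAlgebra e PatClass.denote_injective
      Iff.rfl Iff.rfl hsup hinf done dzero hcompl
      (fun x y => by rw [sdiff_eq, ← hcompl]; exact hinf _ _)
      (fun x y => by rw [himp_eq, ← hcompl]; exact hsup _ _)
    refine ⟨inst, fun 𝓜 𝓝 => ?_, fun 𝓜 𝓝 => ?_, fun 𝓜 => ?_, rfl, rfl⟩
    · exact PatClass.denote_injective ((hsup _ _).trans (dcup 𝓜 𝓝).symm)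
    · exact PatClass.denote_injective ((hinf _ _).trans (dcap 𝓜 𝓝).symm)
    · exact PatClass.denote_injective ((hcompl _).trans (dneg 𝓜).symm)
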